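/- **Model.** For each $n\in\mathbb N$ consider a market with $n$ potential suppliers. A global state $A$ takes values in a finite set $\mathcal A$. Given $A=a$, the following hold. * The demand $D\ge 0$ has law $F^{(n)}_a$, and for constants $d_a>0$: $E[D/n\mid A=a]=d_a$ for $n\ge 1$, $E[(D/n-d_a)^2\mid A=a]\to0$ and $P(D/n\notin[d_a/2,2d_a]\mid A=a)=o(1/n)$ as $n\to\infty$. * Payments $P_i\sim\pi$ and private features $B_i\sim\beta_a$, $1\le i\le n$, are i.i.d., independent of each other and of $D$. Supplier $i$ is active ($Z_i=1$; otherwise $Z_i=0$), independently across $i$ and independently of $D$, with $$P(Z_i=1\mid P_i,B_i,A=a)=f_{B_i}\big(P_i\,E[\Omega(D,T)\mid A=a]\big),\qquad T=\sum_{i=1}^n Z_i ,$$ where the $T$ that suppliers anticipate is the one that results from their choices (equilibrium). * An active supplier $i$ serves an amount $S_i$ of demand with $E[S_i\mid D,T,A=a]=\Omega(D,T)$. The platform's utility is $U=R(D,T)-\sum_{i} P_iZ_iS_i$, and $u^{(n)}_a(\pi)=\frac1n E[U\mid A=a]$. **Assumptions.** (Throughout, "error function" means a bounded function $l$ on $[0,\infty)^2$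 with $|l(d,t)|=o(1/\sqrt t+1/\sqrt d)$ as $d,t\to\infty$.) 1. $\Omega:[0,\infty)^2\to[0,\infty)$ is non-decreasing in $d$, non-increasing in $t$, $\Omega(\cdot,0)$ is bounded, and $\Omega(d,t)=\omega(d/t)+l(d,t)$ for $d\ge 0$, $t>0$, with an error function $l$ and a regular allocation function $\omega:[0,\infty)\to[0,1]$: $\omega$ is concave, non-decreasing, smooth on $(0,\infty)$, $\omega(0)=\lim_{x\to0}\omega(x)=0$, $\lim_{x\to\infty}\omega(x)\le1$, $\lim_{x\to0}\omega'(x)\le1$. 2. Each $f_b:[0,\infty)\to[0,1]$ is non-decreasing and twice differentiable, with second derivatives bounded uniformly in $b$ and $x$. 3. $R(d,t)=(r(d/t)-l(d,t))\,t$ for $d\ge0$, $t>0$, with an error function $l$, $R(d,0)=0$, and $r$ is smooth on $(0,\infty)$ with bounded derivative. Call a payment $p>0$ *viable in state $a$* if $E[f_{B_1}(p\,\omega(x))\mid A=a]>0$ for some $x>0$. **Theorem.** Under these assumptions, let $0<\zeta<p$, $0<\alpha<1/2$, and let $p$ be viable in every state $a\in\mathcal A$. (a) For every $a$ and every $p'>0$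 viable in state $a$, the equation $\mu=E[f_{B_1}(p'\omega(d_a/\mu))\mid A=a]$ has exactly one solution $\mu=\mu_a(p')\in(0,1]$, and when all payments equal $p'$ (and $P(A=a)>0$), $$\lim_{n\to\infty}u_a^{(n)}(\delta_{p'})=u_a(p'):=\big(r(d_a/\mu_a(p'))-p'\omega(d_a/\mu_a(p'))\big)\mu_a(p').$$ (b) For every $a$, the mean-field utility $u_a$ is differentiable at $p$. (c) Let the payments in the $n$-th market be $P_i=p+\zeta_n\varepsilon_i$ with $\zeta_n=\zeta n^{-\alpha}$ and $\varepsilon_i$ i.i.d. uniform on $\{-1,1\}$. Put $\bar D=D/n$, $\bar Z=\frac1n\sum_i Z_i$, $\bar\varepsilon=\frac1n\sum_i\varepsilon_i$, $$\hat\Delta=\zeta_n^{-1}\,\frac{\sum_{i=1}^n(Z_i-\bar Z)(\varepsilon_i-\bar\varepsilon)}{\sum_{i=1}^n(\varepsilon_i-\bar\varepsilon)^2},\qquad \hat\Upsilon=\hat\Delta\Big/\Big(1+\frac{p\,\bar D\,\hat\Delta\,\omega'(\bar D/\bar Z)}{\bar Z^2\,\omega(\bar D/\bar Z)}\Big),$$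 $$\hat\Gamma=\hat\Upsilon\Big[r(\bar D/\bar Z)-p\,\omega(\bar D/\bar Z)-\big(r'(\bar D/\bar Z)-p\,\omega'(\bar D/\bar Z)\big)\bar D/\bar Z\Big]-\omega(\bar D/\bar Z)\,\bar Z$$ (a quotient with denominator $0$ is read as $0$). Then for every $\delta>0$ $$\lim_{n\to\infty}P\big(\big|\hat\Gamma-u_A'(p)\big|>\delta\big)=0 .$$ -/

import Mathlib

open MeasureTheory ProbabilityTheory Filter Topology Asymptotics

universe u v w

noncomputable section

/-- The primitives of the stochastic market, with global states in `𝒜` and private supplier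
features in `ℬ`. Functions on `ℝ₊` are represented by functions on `ℝ` of which only the values on
`[0, ∞)` are constrained and used. -/
structure Market (𝒜 ℬ : Type*) [MeasurableSpace ℬ] where
  /-- law of the demand `D` in the `n`-th system, conditionally on `A = a` -/
  demandLaw : ℕ → 𝒜 → Measure ℝ
  /-- the constants `d_a` -/
  demandMean : 𝒜 → ℝ
  /-- law of the private feature of a supplier, conditionally on `A = a` -/
  featureLaw : 𝒜 → Measure ℬ
  /-- the choice functions `f_b(x)` -/
  choice : ℬ → ℝ → ℝ
  /-- the expected allocation `Ω(d, t)` to an active supplier -/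
  alloc : ℝ → ℝ → ℝ
  /-- the limiting allocation function `ω` -/
  allocLim : ℝ → ℝ
  /-- the platform's revenue `R(d, t)` -/
  revenue : ℝ → ℝ → ℝ
  /-- the limiting revenue function `r` -/
  revenueLim : ℝ → ℝ

/-- Regular allocation functions `ω : ℝ₊ → [0, 1]`, with `ω 0` the limit of `ω` at `0`. -/
structure IsRegularAllocation (ω : ℝ → ℝ) : Prop where
  mem_Icc : ∀ x, 0 ≤ x → ω x ∈ Set.Icc (0 : ℝ) 1
  smooth : ContDiffOn ℝ (⊤ : ℕ∞) ω (Set.Ioi 0)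
  concave : ConcaveOn ℝ (Set.Ici 0) ω
  mono : MonotoneOn ω (Set.Ici 0)
  at_zero : ω 0 = 0
  tendsto_zero : Tendsto ω (𝓝[>] 0) (𝓝 0)
  tendsto_top : ∃ c ≤ 1, Tendsto ω atTop (𝓝 c)
  deriv_zero : ∃ c ≤ 1, Tendsto (deriv ω) (𝓝[>] 0) (𝓝 c)

/-- A bounded function on `ℝ₊²` with `|l(d, t)| = o(1/√t + 1/√d)` as `d, t → ∞`. -/
structure IsErrorFunction (l : ℝ → ℝ → ℝ) : Prop where
  bounded : ∃ C, ∀ d t, 0 ≤ d → 0 ≤ t → |l d t| ≤ C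
  isLittleO : (fun x : ℝ × ℝ => l x.1 x.2) =o[atTop ×ˢ atTop]
    fun x : ℝ × ℝ => 1 / √x.2 + 1 / √x.1

namespace Market

variable {𝒜 ℬ : Type*} [MeasurableSpace ℬ]

/-- Assumptions on demand: `D ≥ 0`, `E[D/n | A = a] = d_a > 0`, `E[(D/n - d_a)² | A = a] → 0` and
`P(D/n ∉ [d_a/2, 2 d_a] | A = a) = o(1/n)`. -/
structure DemandAssumption (M : Market 𝒜 ℬ) : Prop where
  isProb : ∀ n a, IsProbabilityMeasure (M.demandLaw n a)
  nonneg : ∀ n a, ∀ᵐ x ∂M.demandLaw n a, 0 ≤ x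
  mean_pos : ∀ a, 0 < M.demandMean a
  integrable : ∀ n a, Integrable (fun x : ℝ => x) (M.demandLaw n a)
  mean_eq : ∀ n a, 0 < n → ∫ x, x / (n : ℝ) ∂M.demandLaw n a = M.demandMean a
  concentrates : ∀ a, Tendsto
    (fun n : ℕ => ∫⁻ x, ENNReal.ofReal ((x / (n : ℝ) - M.demandMean a) ^ 2) ∂M.demandLaw n a)
    atTop (𝓝 0)
  tail : ∀ a, (fun n : ℕ => (M.demandLaw n a).real
      {x | x / (n : ℝ) ∉ Set.Icc (M.demandMean a / 2) (2 * M.demandMean a)})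
    =o[atTop] fun n : ℕ => 1 / (n : ℝ)

/-- Assumptions on the allocation: monotonicity, and `Ω(d, t) = ω(d/t) + l(d, t)`. When there are no
active suppliers the ratio `d/t` is meaningless, and only boundedness remains. -/
structure AllocationAssumption (M : Market 𝒜 ℬ) : Prop where
  nonneg : ∀ d t, 0 ≤ d → 0 ≤ t → 0 ≤ M.alloc d t
  mono_demand : ∀ t, 0 ≤ t → MonotoneOn (fun d => M.alloc d t) (Set.Ici 0)
  anti_supply : ∀ d, 0 ≤ d → AntitoneOn (fun t => M.alloc d t) (Set.Ici 0)
  bounded_zero : ∃ C, ∀ d, 0 ≤ d → M.alloc d 0 ≤ C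
  regular : IsRegularAllocation M.allocLim
  approx : ∃ l : ℝ → ℝ → ℝ, IsErrorFunction l ∧
    ∀ d t, 0 ≤ d → 0 < t → M.alloc d t = M.allocLim (d / t) + l d t

/-- Assumptions on the choice functions: values in `[0, 1]`, non-decreasing, twice differentiable on
`[0, ∞)` with a second derivative that is bounded uniformly in the private feature. -/
structure ChoiceAssumption (M : Market 𝒜 ℬ) : Prop where
  isProb : ∀ a, IsProbabilityMeasure (M.featureLaw a)
  measurable : ∀ x, 0 ≤ x → Measurable fun b => M.choice b x
  mem_Icc : ∀ b x, 0 ≤ x → M.choice b x ∈ Set.Icc (0 : ℝ) 1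
  mono : ∀ b, MonotoneOn (M.choice b) (Set.Ici 0)
  twice_diff : ∃ K : ℝ, ∀ b, ∃ f' f'' : ℝ → ℝ, ∀ x, 0 ≤ x →
    HasDerivWithinAt (M.choice b) (f' x) (Set.Ici 0) x ∧
    HasDerivWithinAt f' (f'' x) (Set.Ici 0) x ∧ |f'' x| ≤ K

/-- Assumptions on the revenue: `R(d, t) = (r(d/t) - l(d, t)) t`, so that there is no revenue
without active suppliers, and `r` is smooth with bounded derivative. -/
structure RevenueAssumption (M : Market 𝒜 ℬ) : Prop where
  measurable : ∀ t, Measurable fun d => M.revenue d t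
  zero_supply : ∀ d, 0 ≤ d → M.revenue d 0 = 0
  smooth : ContDiffOn ℝ (⊤ : ℕ∞) M.revenueLim (Set.Ioi 0)
  deriv_bounded : ∃ C, ∀ x, 0 < x → |deriv M.revenueLim x| ≤ C
  approx : ∃ l : ℝ → ℝ → ℝ, IsErrorFunction l ∧
    ∀ d t, 0 ≤ d → 0 < t → M.revenue d t = (M.revenueLim (d / t) - l d t) * t

/-- At payment `p` and in state `a`, a supplier becomes active with positive probability
if demand per active supplier is abundant enough. -/
def Viable (M : Market 𝒜 ℬ) (a : 𝒜) (p : ℝ) : Prop :=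
  ∃ x > 0, 0 < ∫ b, M.choice b (p * M.allocLim x) ∂M.featureLaw a

/-- `μ ∈ (0, 1]` solves the mean-field balance equation `μ = E[f_B(p ω(d_a/μ)) | A = a]`. -/
def IsMeanFieldSupply (M : Market 𝒜 ℬ) (a : 𝒜) (p μ : ℝ) : Prop :=
  0 < μ ∧ μ ≤ 1 ∧
    μ = ∫ b, M.choice b (p * M.allocLim (M.demandMean a / μ)) ∂M.featureLaw a

/-- `μ_a(p)`, the solution of the mean-field balance equation. -/
def meanFieldSupply (M : Market 𝒜 ℬ) (a : 𝒜) (p : ℝ) : ℝ :=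
  Classical.epsilon (M.IsMeanFieldSupply a p)

/-- `u_a(p) = (r(d_a/μ_a(p)) - p ω(d_a/μ_a(p))) μ_a(p)`. -/
def meanFieldUtility (M : Market 𝒜 ℬ) (a : 𝒜) (p : ℝ) : ℝ :=
  (M.revenueLim (M.demandMean a / M.meanFieldSupply a p)
    - p * M.allocLim (M.demandMean a / M.meanFieldSupply a p)) * M.meanFieldSupply a p

end Market

/-- One period of the `n`-th market, in equilibrium, under the payment distribution `π`. The
equilibrium condition is the field `choice_eq`: the number of active suppliers that the suppliers
anticipate when they choose is, in distribution, the number `∑ j, Z j` of active suppliers that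
results from their choices. -/
structure EquilibriumPeriod {𝒜 : Type v} {ℬ : Type w} [MeasurableSpace 𝒜]
    [MeasurableSpace ℬ] (M : Market 𝒜 ℬ) (n : ℕ) (π : Measure ℝ) where
  /-- the sample space -/
  Sample : Type u
  [measurableSpace : MeasurableSpace Sample]
  /-- the probability -/
  Pr : Measure Sample
  isProb : IsProbabilityMeasure Pr
  /-- the global state -/
  A : Sample → 𝒜
  /-- the demand -/
  D : Sample → ℝ
  /-- the payments -/
  P : Fin n → Sample → ℝ
  /-- the private features -/
  B : Fin n → Sample → ℬ
  /-- the participation decisions -/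
  Z : Fin n → Sample → ℝ
  /-- the amounts of demand that active suppliers serve -/
  S : Fin n → Sample → ℝ
  measurable_A : Measurable A
  measurable_D : Measurable D
  measurable_P : ∀ i, Measurable (P i)
  measurable_B : ∀ i, Measurable (B i)
  measurable_Z : ∀ i, Measurable (Z i)
  Z_eq : ∀ i ω, Z i ω = 0 ∨ Z i ω = 1
  law_D : ∀ a, Pr (A ⁻¹' {a}) ≠ 0 → (Pr[|A ⁻¹' {a}]).map D = M.demandLaw n a
  law_PB : ∀ a, Pr (A ⁻¹' {a}) ≠ 0 → ∀ i,
    (Pr[|A ⁻¹' {a}]).map (fun ω => (P i ω, B i ω)) = π.prod (M.featureLaw a)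
  indep_suppliers : ∀ a, Pr (A ⁻¹' {a}) ≠ 0 →
    iIndepFun (fun i ω => (P i ω, B i ω, Z i ω)) (Pr[|A ⁻¹' {a}])
  indep_D : ∀ a, Pr (A ⁻¹' {a}) ≠ 0 →
    IndepFun D (fun ω i => (P i ω, B i ω, Z i ω)) (Pr[|A ⁻¹' {a}])
  /-- `P(Z_i = 1 | P_i, B_i, A = a) = f_{B_i}(P_i E[Ω(D, T) | A = a])` with `T = ∑ j, Z_j` -/
  choice_eq : ∀ a, Pr (A ⁻¹' {a}) ≠ 0 → ∀ i,
    (Pr[|A ⁻¹' {a}])[Z i | MeasurableSpace.comap (fun ω => (P i ω, B i ω)) inferInstance]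
      =ᵐ[Pr[|A ⁻¹' {a}]] fun ω => M.choice (B i ω)
        (P i ω * ∫ ω', M.alloc (D ω') (∑ j, Z j ω') ∂Pr[|A ⁻¹' {a}])
  integrable_S : ∀ a i, Integrable (S i) (Pr[|A ⁻¹' {a} ∩ Z i ⁻¹' {1}])
  /-- for an active supplier `i`, `E[S_i | D, T, A = a] = Ω(D, T)` -/
  alloc_eq : ∀ a i,
    (Pr[|A ⁻¹' {a} ∩ Z i ⁻¹' {1}])[S i |
        MeasurableSpace.comap (fun ω => (D ω, ∑ j, Z j ω)) inferInstance]
      =ᵐ[Pr[|A ⁻¹' {a} ∩ Z i ⁻¹' {1}]] fun ω => M.alloc (D ω) (∑ j, Z j ω)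

attribute [instance] EquilibriumPeriod.measurableSpace EquilibriumPeriod.isProb

/-- The expected utility `u_a^{(n)}(π) = E[R(D, T) - ∑ P_i Z_i S_i | A = a] / n`. -/
def EquilibriumPeriod.utility {𝒜 : Type v} {ℬ : Type w} [MeasurableSpace 𝒜]
    [MeasurableSpace ℬ] {M : Market 𝒜 ℬ} {n : ℕ} {π : Measure ℝ}
    (X : EquilibriumPeriod.{u} M n π) (a : 𝒜) : ℝ :=
  (1 / (n : ℝ)) * ∫ ω, (M.revenue (X.D ω) (∑ j, X.Z j ω) - ∑ i, X.P i ω * X.Z i ω * X.S i ω)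
    ∂(X.Pr)[|X.A ⁻¹' {a}]

/-- The law of `p + ζ ε` with `ε` uniform on `{-1, 1}`. -/
def perturbedPayment (p ζ : ℝ) : Measure ℝ :=
  (2⁻¹ : ENNReal) • Measure.dirac (p + ζ) + (2⁻¹ : ENNReal) • Measure.dirac (p - ζ)

/-- Sample average. -/
def sampleMean {n : ℕ} (x : Fin n → ℝ) : ℝ := (∑ i, x i) / n

/-- `Δ̂`, the regression coefficient of the `Z_i` on the perturbations `ζ ε_i`. -/
def deltaHat {n : ℕ} (ζ : ℝ) (Z ε : Fin n → ℝ) : ℝ :=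
  ζ⁻¹ * (∑ i, (Z i - sampleMean Z) * (ε i - sampleMean ε)) / ∑ i, (ε i - sampleMean ε) ^ 2

/-- `Υ̂`, as a function of `p`, `D̄`, `Z̄` and `Δ̂`. -/
def upsilonHat (ω : ℝ → ℝ) (p Dbar Zbar Δ : ℝ) : ℝ :=
  Δ / (1 + p * Dbar * Δ * deriv ω (Dbar / Zbar) / (Zbar ^ 2 * ω (Dbar / Zbar)))

/-- `Γ̂`, as a function of `p`, `D̄`, `Z̄` and `Δ̂`. -/
def gammaHat (ω r : ℝ → ℝ) (p Dbar Zbar Δ : ℝ) : ℝ :=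
  upsilonHat ω p Dbar Zbar Δ *
      (r (Dbar / Zbar) - p * ω (Dbar / Zbar)
        - (deriv r (Dbar / Zbar) - p * deriv ω (Dbar / Zbar)) * (Dbar / Zbar))
    - ω (Dbar / Zbar) * Zbar

end

/-! Fix a state `a` and write F(x) = E[f_B(x)], d for the mean of relative demand and μ for the
mean-field supply. A supplier reacts to the market only through the number q = E[Ω(D, T)]. Given the
state, the Z_i are therefore i.i.d., and Chebyshev puts Z̄ within O(n^(-1/2)) of their mean m, which
is F(pq) up to an error proportional to the perturbation.

The location of m follows from negative feedback (`eventually_abs_activeProb_sub_lt`). If m exceeded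
μ by a fixed amount, supply would be high, q could hardly exceed ω(d/μ), and so m ≈ F(pq) could
hardly exceed F(pω(d/μ)) = μ; the other side is symmetric. Hence m → μ and q → ω(d/μ) in every
equilibrium. Equilibria at finite n need not be unique, so the estimates are stated for all periods
of a large size at once.

Utilities: per potential supplier, the utility is nearly a continuous function of D/n and T/n, with
at most linear growth in D/n. Mean-square convergence of D/n controls the tail
(`eventually_abs_integral_sub_le`).

Differentiability: monotonicity of both sides of μ = F(pω(d/μ)) makes μ unique and Lipschitz in p.
Differentiating the equation then gives μ' = Δ / (1 + p d Δ ω' / (μ² ω)) with Δ = ω F'(pω), which is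
the population form of Υ̂; the product and chain rules turn it into that of Γ̂.

Estimator: suppliers with either sign face the same q, so E[Z_i ε_i] / ζ_n is a symmetric difference
quotient of s ↦ F((p + s)q) and tends to Δ, the response of supply without feedback. Sampling noise
n^(-1/2) / ζ_n vanishes because n ζ_n² → ∞. As Γ̂ is continuous in (D̄, Z̄, Δ̂) at (d, μ, Δ)
(`continuousAt_gammaHat`), it is consistent in each state, and there are finitely many states. -/

/-! ### The averaged choice function -/

/-- A function on `[0, ∞)` with values in `[0, 1]` whose second derivative is at most `K` in
absolute value has a first derivative that is at most `1 + K` in absolute value, `K`-Lipschitz,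
and approximates increments to second order. -/
lemma taylor_bounds_of_second_deriv_bound {f f' f'' : ℝ → ℝ} {K : ℝ}
    (hf : ∀ x, 0 ≤ x → f x ∈ Set.Icc (0 : ℝ) 1)
    (h : ∀ x, 0 ≤ x → HasDerivWithinAt f (f' x) (Set.Ici 0) x ∧
      HasDerivWithinAt f' (f'' x) (Set.Ici 0) x ∧ |f'' x| ≤ K) :
    (∀ x y, 0 ≤ x → 0 ≤ y → |f' y - f' x| ≤ K * |y - x|) ∧
    (∀ x y, 0 ≤ x → 0 ≤ y → |f y - f x - f' x * (y - x)| ≤ K * (y - x) ^ 2) ∧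
    (∀ x, 0 ≤ x → |f' x| ≤ 1 + K) := by
  have hlip : ∀ x y, 0 ≤ x → 0 ≤ y → |f' y - f' x| ≤ K * |y - x| := by
    intro x y hx hy
    have := (convex_Ici (0 : ℝ)).norm_image_sub_le_of_norm_hasDerivWithin_le
      (f := f') (f' := f'') (C := K) (fun z hz => (h z hz).2.1) (fun z hz => (h z hz).2.2)
      (x := x) (y := y) hx hy
    simpa [Real.norm_eq_abs] using this
  have htaylor : ∀ x y, 0 ≤ x → 0 ≤ y → |f y - f x - f' x * (y - x)| ≤ K * (y - x) ^ 2 := by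
    intro x y hx hy
    have hK : 0 ≤ K := (abs_nonneg _).trans (h x hx).2.2
    have hsub : Set.uIcc x y ⊆ Set.Ici 0 := fun z hz => (le_min hx hy).trans hz.1
    -- Mean value inequality for z ↦ f z - f' x * z, whose derivative f' z - f' x is at most K|y -
    -- x| between x and y.
    have := (convex_uIcc x y).norm_image_sub_le_of_norm_hasDerivWithin_le
      (f := fun z => f z - f' x * z) (f' := fun z => f' z - f' x) (C := K * |y - x|)
      (fun z hz => by
        have := ((h z (hsub hz)).1.mono hsub).sub
          ((hasDerivWithinAt_id z (Set.uIcc x y)).const_mul (f' x))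
        simp only [mul_one] at this
        exact this)
      (fun z hz => (hlip x z hx (hsub hz)).trans <| by
        have : |z - x| ≤ |y - x| := Set.abs_sub_left_of_mem_uIcc hz
        gcongr)
      Set.left_mem_uIcc Set.right_mem_uIcc
    rw [Real.norm_eq_abs, Real.norm_eq_abs, mul_assoc, abs_mul_abs_self] at this
    convert this using 2 <;> ring
  refine ⟨hlip, htaylor, fun x hx => ?_⟩
  -- Over a step of length 1, f' x is an increment of f, at most 1 in size, up to a remainder of at
  -- most K.
  have h1 := htaylor x (x + 1) hx (by linarith)
  have h2 := hf x hx
  have h3 := hf (x + 1) (by linarith)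
  rw [abs_le] at *
  constructor <;> nlinarith [h1.1, h1.2, h2.1, h2.2, h3.1, h3.2]

namespace Market

variable {𝒜 : Type v} {ℬ : Type w} [MeasurableSpace ℬ]

/-- The probability `E[f_B(x) | A = a]` that a supplier with prospective earnings `x` is active. -/
noncomputable def choiceMean (M : Market 𝒜 ℬ) (a : 𝒜) (x : ℝ) : ℝ :=
  ∫ b, M.choice b x ∂M.featureLaw a

section

variable {M : Market 𝒜 ℬ}

lemma ChoiceAssumption.integrable_choice (hf : M.ChoiceAssumption) (a : 𝒜) {x : ℝ} (hx : 0 ≤ x) :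
    Integrable (fun b => M.choice b x) (M.featureLaw a) := by
  have := hf.isProb a
  refine Integrable.of_bound (hf.measurable x hx).aestronglyMeasurable 1 (.of_forall fun b => ?_)
  have := hf.mem_Icc b x hx
  rw [Real.norm_eq_abs, abs_le]
  exact ⟨by linarith [this.1], this.2⟩

lemma ChoiceAssumption.choiceMean_mem_Icc (hf : M.ChoiceAssumption) (a : 𝒜) {x : ℝ}
    (hx : 0 ≤ x) : M.choiceMean a x ∈ Set.Icc (0 : ℝ) 1 := by
  have := hf.isProb a
  refine ⟨integral_nonneg fun b => (hf.mem_Icc b x hx).1, ?_⟩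
  calc M.choiceMean a x ≤ ∫ _, (1 : ℝ) ∂M.featureLaw a :=
        integral_mono (hf.integrable_choice a hx) (integrable_const _)
          fun b => (hf.mem_Icc b x hx).2
    _ = 1 := by simp

lemma ChoiceAssumption.choiceMean_mono (hf : M.ChoiceAssumption) (a : 𝒜) {x y : ℝ}
    (hx : 0 ≤ x) (hxy : x ≤ y) : M.choiceMean a x ≤ M.choiceMean a y :=
  integral_mono (hf.integrable_choice a hx) (hf.integrable_choice a (hx.trans hxy))
    fun b => hf.mono b hx (hx.trans hxy) hxy

/-- The averaged choice function has a bounded Lipschitz derivative on `[0, ∞)`. -/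
lemma ChoiceAssumption.exists_choiceMean_deriv (hf : M.ChoiceAssumption) (a : 𝒜) :
    ∃ (K : ℝ) (G : ℝ → ℝ), 0 ≤ K ∧ (∀ x, 0 ≤ x → 0 ≤ G x ∧ G x ≤ 1 + K) ∧
      (∀ x y, 0 ≤ x → 0 ≤ y → |G y - G x| ≤ K * |y - x|) ∧
      (∀ x y, 0 ≤ x → 0 ≤ y →
        |M.choiceMean a y - M.choiceMean a x - G x * (y - x)| ≤ K * (y - x) ^ 2) := by
  obtain ⟨K, hK⟩ := hf.twice_diff
  choose f' f'' h using hK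
  have hprob := hf.isProb a
  have hbd := fun b => taylor_bounds_of_second_deriv_bound (hf.mem_Icc b) (h b)
  have hK0 : 0 ≤ K := by
    obtain ⟨b⟩ := hprob.neZero.out |> fun h => (M.featureLaw a).nonempty_of_neZero
    exact (abs_nonneg _).trans (h b 0 le_rfl).2.2
  -- Measurability in b is known for the choice functions only. It passes to f' as a limit of
  -- difference quotients, with error at most K/(n + 1).
  have hmeas : ∀ x, 0 ≤ x → Measurable fun b => f' b x := by
    intro x hx
    have hpos : ∀ n : ℕ, (0 : ℝ) < 1 / ((n : ℝ) + 1) := fun n => Nat.one_div_pos_of_nat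
    refine measurable_of_tendsto_metrizable
      (f := fun (n : ℕ) b => (M.choice b (x + 1 / ((n : ℝ) + 1)) - M.choice b x)
        / (1 / ((n : ℝ) + 1)))
      (fun n => ((hf.measurable _ (by linarith [hpos n])).sub (hf.measurable x hx)).div_const _)
      (tendsto_pi_nhds.2 fun b => ?_)
    rw [tendsto_iff_norm_sub_tendsto_zero]
    have hlim : Tendsto (fun n : ℕ => K * (1 / ((n : ℝ) + 1))) atTop (𝓝 0) := by
      simpa using tendsto_one_div_add_atTop_nhds_zero_nat.const_mul K
    refine squeeze_zero (fun _ => norm_nonneg _) (fun n => ?_) hlim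
    have := (hbd b).2.1 x (x + 1 / ((n : ℝ) + 1)) hx (by linarith [hpos n])
    have hp := hpos n
    set s := 1 / ((n : ℝ) + 1)
    rw [add_sub_cancel_left] at this
    rw [Real.norm_eq_abs, div_sub' hp.ne', abs_div, abs_of_pos hp, div_le_iff₀ hp]
    calc _ = |M.choice b (x + s) - M.choice b x - f' b x * s| := by ring_nf
      _ ≤ _ := this
      _ = _ := by ring
  have hint : ∀ x, 0 ≤ x → Integrable (fun b => f' b x) (M.featureLaw a) := fun x hx =>
    Integrable.of_bound (hmeas x hx).aestronglyMeasurable (1 + K)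
      (.of_forall fun b => (hbd b).2.2 x hx)
  have hnn : ∀ b x, 0 ≤ x → 0 ≤ f' b x := fun b x hx =>
    (hf.mono b).derivWithin_nonneg.trans_eq
      ((h b x hx).1.derivWithin (uniqueDiffOn_Ici 0 x hx))
  have habs : ∀ (g : ℬ → ℝ) (C : ℝ), (∀ b, |g b| ≤ C) → |∫ b, g b ∂M.featureLaw a| ≤ C := by
    intro g C hg
    have := norm_integral_le_of_norm_le_const (μ := M.featureLaw a) (f := g) (C := C)
      (.of_forall hg)
    simpa using this
  refine ⟨K, fun x => ∫ b, f' b x ∂M.featureLaw a, hK0, fun x hx => ⟨?_, ?_⟩, ?_, ?_⟩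
  · exact integral_nonneg fun b => hnn b x hx
  · exact (le_abs_self _).trans (habs _ _ fun b => (hbd b).2.2 x hx)
  · intro x y hx hy
    rw [← integral_sub (hint y hy) (hint x hx)]
    exact habs _ _ fun b => (hbd b).1 x y hx hy
  · intro x y hx hy
    have hi := fun {z : ℝ} (hz : 0 ≤ z) => hf.integrable_choice a hz
    rw [choiceMean, choiceMean, ← integral_sub (hi hy) (hi hx), ← integral_mul_const,
      ← integral_sub (f := fun b => M.choice b y - M.choice b x) ((hi hy).sub (hi hx))
        ((hint x hx).mul_const _)]
    exact habs _ _ fun b => (hbd b).2.1 x y hx hy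

/-- The averaged choice function is Lipschitz on `[0, ∞)`. -/
lemma ChoiceAssumption.exists_choiceMean_lipschitz (hf : M.ChoiceAssumption) (a : 𝒜) :
    ∃ L : ℝ, 0 < L ∧ ∀ x y, 0 ≤ x → 0 ≤ y →
      |M.choiceMean a y - M.choiceMean a x| ≤ L * |y - x| := by
  obtain ⟨K, G, hK, hG, -, hT⟩ := hf.exists_choiceMean_deriv a
  -- For |y - x| ≤ 1, the slope contributes 1 + K and the quadratic remainder K. For larger gaps,
  -- values in [0, 1] suffice.
  refine ⟨1 + 2 * K, by positivity, fun x y hx hy => ?_⟩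
  rcases le_total |y - x| 1 with h1 | h1
  · have h2 := hT x y hx hy
    have h3 : |G x * (y - x)| ≤ (1 + K) * |y - x| := by
      rw [abs_mul, abs_of_nonneg (hG x hx).1]
      exact mul_le_mul_of_nonneg_right (hG x hx).2 (abs_nonneg _)
    have h4 : K * (y - x) ^ 2 ≤ K * |y - x| := by
      rw [← sq_abs]
      exact mul_le_mul_of_nonneg_left (by nlinarith [abs_nonneg (y - x)]) hK
    calc |M.choiceMean a y - M.choiceMean a x|
        = |(M.choiceMean a y - M.choiceMean a x - G x * (y - x)) + G x * (y - x)| := by ring_nf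
      _ ≤ _ := abs_add_le _ _
      _ ≤ _ := by linarith
  · have hx1 := hf.choiceMean_mem_Icc a hx
    have hy1 := hf.choiceMean_mem_Icc a hy
    have : |M.choiceMean a y - M.choiceMean a x| ≤ 1 := by
      rw [abs_le]; constructor <;> linarith [hx1.1, hx1.2, hy1.1, hy1.2]
    nlinarith

end

end Market

/-! ### Regular allocation functions -/

namespace IsRegularAllocation

variable {ω : ℝ → ℝ}

lemma contDiffAt (h : IsRegularAllocation ω) {x : ℝ} (hx : 0 < x) :
    ContDiffAt ℝ (⊤ : ℕ∞) ω x :=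
  h.smooth.contDiffAt (Ioi_mem_nhds hx)

lemma hasDerivAt (h : IsRegularAllocation ω) {x : ℝ} (hx : 0 < x) :
    HasDerivAt ω (deriv ω x) x :=
  ((h.contDiffAt hx).differentiableAt (by simp)).hasDerivAt

lemma deriv_nonneg (h : IsRegularAllocation ω) {x : ℝ} (hx : 0 < x) : 0 ≤ deriv ω x := by
  rw [← (h.hasDerivAt hx).hasDerivWithinAt.derivWithin (uniqueDiffOn_Ici 0 x hx.le)]
  exact h.mono.derivWithin_nonneg

/-- A regular allocation function is identically zero or positive on `(0, ∞)`. -/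
lemma eq_zero_or_pos (h : IsRegularAllocation ω) :
    (∀ x, 0 ≤ x → ω x = 0) ∨ ∀ x, 0 < x → 0 < ω x := by
  by_contra! hcon
  obtain ⟨⟨y, hy, hy'⟩, x, hx, hx'⟩ := hcon
  have hypos : 0 < ω y := lt_of_le_of_ne (h.mem_Icc y hy).1 hy'.symm
  have hxy : x < y := by
    by_contra! hle
    linarith [h.mono (Set.mem_Ici.2 hy) (Set.mem_Ici.2 hx.le) hle]
  have hy0 : 0 < y := hx.trans hxy
  have hs : 0 ≤ 1 - x / y := by rw [sub_nonneg, div_le_one hy0]; exact hxy.le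
  have hs' : 0 ≤ x / y := by positivity
  -- The chord from 0 to y lies below the graph, so ω x ≥ (x/y) ω y > 0.
  have := h.concave.2 (Set.mem_Ici.2 le_rfl) (Set.mem_Ici.2 hy) hs hs' (by ring)
  simp only [smul_eq_mul, mul_zero, zero_add, h.at_zero, div_mul_cancel₀ x hy0.ne'] at this
  have : 0 < x / y * ω y := by positivity
  linarith

end IsRegularAllocation

lemma ContDiffOn.continuousAt_deriv_of_pos {r : ℝ → ℝ} (h : ContDiffOn ℝ (⊤ : ℕ∞) r (Set.Ioi 0))
    {x : ℝ} (hx : 0 < x) : ContinuousAt (deriv r) x :=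
  (h.continuousOn_deriv_of_isOpen isOpen_Ioi (by simp)).continuousAt (Ioi_mem_nhds hx)

lemma ContDiffOn.hasDerivAt_of_pos {r : ℝ → ℝ} (h : ContDiffOn ℝ (⊤ : ℕ∞) r (Set.Ioi 0))
    {x : ℝ} (hx : 0 < x) : HasDerivAt r (deriv r x) x :=
  ((h.contDiffAt (Ioi_mem_nhds hx)).differentiableAt (by simp)).hasDerivAt

/-! ### The mean-field balance equation -/

namespace Market

variable {𝒜 : Type v} {ℬ : Type w} [MeasurableSpace ℬ] {M : Market 𝒜 ℬ}

lemma AllocationAssumption.choiceMean_allocLim_mono (hΩ : M.AllocationAssumption)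
    (hf : M.ChoiceAssumption) (a : 𝒜) {p x y : ℝ} (hp : 0 ≤ p) (hx : 0 ≤ x) (hxy : x ≤ y) :
    M.choiceMean a (p * M.allocLim x) ≤ M.choiceMean a (p * M.allocLim y) :=
  hf.choiceMean_mono a (mul_nonneg hp (hΩ.regular.mem_Icc x hx).1)
    (mul_le_mul_of_nonneg_left (hΩ.regular.mono hx (hx.trans hxy) hxy) hp)

/-- The mean-field balance equation has exactly one solution for a viable payment. -/
lemma Viable.existsUnique_isMeanFieldSupply (hD : M.DemandAssumption)
    (hΩ : M.AllocationAssumption) (hf : M.ChoiceAssumption) {a : 𝒜} {p : ℝ} (hp : 0 < p)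
    (hv : M.Viable a p) : ∃! μ, M.IsMeanFieldSupply a p μ := by
  have hd := hD.mean_pos a
  set d := M.demandMean a
  obtain ⟨x, hx, hc⟩ := hv
  set c := M.choiceMean a (p * M.allocLim x) with hc_def
  change 0 < c at hc
  have hω := hΩ.regular
  obtain ⟨L, hL, hLip⟩ := hf.exists_choiceMean_lipschitz a
  have hFcont : ContinuousOn (M.choiceMean a) (Set.Ici 0) := by
    have : LipschitzOnWith L.toNNReal (M.choiceMean a) (Set.Ici 0) :=
      LipschitzOnWith.of_dist_le_mul fun y hy x hx => by
        rw [Real.dist_eq, Real.dist_eq, Real.coe_toNNReal _ hL.le]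
        exact hLip x y hx hy
    exact this.continuousOn
  -- Left end of the interval for the intermediate value theorem. Since m ≤ d/x, we have d/m ≥ x, so
  -- the right side of the equation at m is at least c ≥ m.
  set m := min c (min (d / x) 1)
  have hm : 0 < m := by positivity
  have hm1 : m ≤ 1 := (min_le_right _ _).trans (min_le_right _ _)
  have hcont : ContinuousOn (fun μ => M.choiceMean a (p * M.allocLim (d / μ)) - μ)
      (Set.Icc m 1) := by
    refine ContinuousOn.sub (hFcont.comp (ContinuousOn.mul continuousOn_const ?_) ?_)
      continuousOn_id
    · intro μ hμ
      have hμ0 : 0 < μ := hm.trans_le hμ.1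
      exact (ContinuousAt.comp (f := fun μ => d / μ)
        (hω.hasDerivAt (div_pos hd hμ0)).continuousAt
        (continuousAt_const.div continuousAt_id hμ0.ne')).continuousWithinAt
    · intro μ hμ
      exact mul_nonneg hp.le (hω.mem_Icc _ (div_pos hd (hm.trans_le hμ.1)).le).1
  have h0 : (0 : ℝ) ∈ Set.Icc (M.choiceMean a (p * M.allocLim (d / 1)) - 1)
      (M.choiceMean a (p * M.allocLim (d / m)) - m) := by
    constructor
    · linarith [(hf.choiceMean_mem_Icc a
        (mul_nonneg hp.le (hω.mem_Icc (d / 1) (by positivity)).1)).2]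
    · have hxm : x ≤ d / m := by
        rw [le_div_iff₀ hm, mul_comm, ← le_div_iff₀ hx]
        exact (min_le_right _ _).trans (min_le_left _ _)
      have := hΩ.choiceMean_allocLim_mono hf a hp.le hx.le hxm
      linarith [min_le_left c (min (d / x) 1)]
  obtain ⟨μ, hμ, hμ0⟩ := intermediate_value_Icc' hm1 hcont h0
  have hμpos : 0 < μ := hm.trans_le hμ.1
  refine ⟨μ, ⟨hμpos, hμ.2, (sub_eq_zero.1 hμ0).symm⟩, ?_⟩
  -- Uniqueness: the right side of the equation is non-increasing in μ, the left side strictly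
  -- increasing.
  have key : ∀ μ₁ μ₂, M.IsMeanFieldSupply a p μ₁ → M.IsMeanFieldSupply a p μ₂ → μ₁ ≤ μ₂ := by
    intro μ₁ μ₂ h₁ h₂
    by_contra! hlt
    have hle : d / μ₁ ≤ d / μ₂ := div_le_div_of_nonneg_left hd.le h₂.1 hlt.le
    have := hΩ.choiceMean_allocLim_mono hf a hp.le (div_pos hd h₁.1).le hle
    have e₁ : μ₁ = M.choiceMean a (p * M.allocLim (d / μ₁)) := h₁.2.2
    have e₂ : μ₂ = M.choiceMean a (p * M.allocLim (d / μ₂)) := h₂.2.2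
    linarith
  have hsol : M.IsMeanFieldSupply a p μ := ⟨hμpos, hμ.2, (sub_eq_zero.1 hμ0).symm⟩
  exact fun ν hν => le_antisymm (key _ _ hν hsol) (key _ _ hsol hν)

lemma Viable.isMeanFieldSupply (hD : M.DemandAssumption) (hΩ : M.AllocationAssumption)
    (hf : M.ChoiceAssumption) {a : 𝒜} {p : ℝ} (hp : 0 < p) (hv : M.Viable a p) :
    M.IsMeanFieldSupply a p (M.meanFieldSupply a p) :=
  Classical.epsilon_spec (hv.existsUnique_isMeanFieldSupply hD hΩ hf hp).exists

/-- Viability is an open condition on the payment. -/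
lemma Viable.eventually (hΩ : M.AllocationAssumption) (hf : M.ChoiceAssumption) {a : 𝒜} {p : ℝ}
    (hp : 0 < p) (hv : M.Viable a p) : ∀ᶠ p' in 𝓝 p, M.Viable a p' := by
  obtain ⟨x, hx, hc⟩ := hv
  obtain ⟨L, hL, hLip⟩ := hf.exists_choiceMean_lipschitz a
  change 0 < M.choiceMean a (p * M.allocLim x) at hc
  have hω := hΩ.regular.mem_Icc x hx.le
  have hlim : ∀ᶠ p' in 𝓝 p,
      |p' * M.allocLim x - p * M.allocLim x| < M.choiceMean a (p * M.allocLim x) / L := by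
    have : Tendsto (fun p' => |p' * M.allocLim x - p * M.allocLim x|) (𝓝 p) (𝓝 0) := by
      have : Continuous fun p' => |p' * M.allocLim x - p * M.allocLim x| := by fun_prop
      simpa using this.tendsto p
    exact this.eventually_lt_const (by positivity)
  filter_upwards [hlim, lt_mem_nhds hp] with p' h1 h2
  refine ⟨x, hx, ?_⟩
  change 0 < M.choiceMean a (p' * M.allocLim x)
  have h3 := hLip (p * M.allocLim x) (p' * M.allocLim x) (mul_nonneg hp.le hω.1)
    (mul_nonneg h2.le hω.1)
  rw [lt_div_iff₀ hL] at h1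
  linarith [(abs_le.1 h3).1]

/-- The mean-field supply is Lipschitz in the payment. -/
lemma AllocationAssumption.abs_meanFieldSupply_sub_le (hΩ : M.AllocationAssumption)
    (hD : M.DemandAssumption) (hf : M.ChoiceAssumption) (a : 𝒜) {L : ℝ}
    (hLip : ∀ x y, 0 ≤ x → 0 ≤ y → |M.choiceMean a y - M.choiceMean a x| ≤ L * |y - x|)
    (hL : 0 ≤ L) {p q μ ν : ℝ} (hp : 0 ≤ p) (hq : 0 ≤ q)
    (hμ : M.IsMeanFieldSupply a p μ) (hν : M.IsMeanFieldSupply a q ν) :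
    |ν - μ| ≤ L * |q - p| := by
  wlog hle : μ ≤ ν generalizing p q μ ν
  · rw [abs_sub_comm, abs_sub_comm q]
    exact this hq hp hν hμ (le_of_not_ge hle)
  have hd := hD.mean_pos a
  have hpos := div_pos hd hμ.1
  have hω := hΩ.regular.mem_Icc _ hpos.le
  -- A larger supply lowers demand per supplier, so replacing ν by μ inside ω only increases the
  -- right side. What remains compares two payments at the same allocation.
  have h1 : ν ≤ M.choiceMean a (q * M.allocLim (M.demandMean a / μ)) :=
    hν.2.2.le.trans (hΩ.choiceMean_allocLim_mono hf a hq (div_pos hd hν.1).le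
      (div_le_div_of_nonneg_left hd.le hμ.1 hle))
  have h2 : μ = M.choiceMean a (p * M.allocLim (M.demandMean a / μ)) := hμ.2.2
  set w := M.allocLim (M.demandMean a / μ)
  have h3 := hLip (p * w) (q * w) (mul_nonneg hp hω.1) (mul_nonneg hq hω.1)
  rw [← sub_mul, abs_mul, abs_of_nonneg hω.1] at h3
  rw [abs_of_nonneg (sub_nonneg.2 hle)]
  have h4 : L * (|q - p| * w) ≤ L * |q - p| :=
    mul_le_mul_of_nonneg_left (mul_le_of_le_one_right (abs_nonneg _) hω.2) hL
  linarith [le_abs_self (M.choiceMean a (q * w) - M.choiceMean a (p * w))]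

/-- The derivative of the averaged choice function at a positive point. -/
lemma hasDerivAt_choiceMean {a : 𝒜} {K : ℝ} {G : ℝ → ℝ}
    (hT : ∀ x y, 0 ≤ x → 0 ≤ y →
      |M.choiceMean a y - M.choiceMean a x - G x * (y - x)| ≤ K * (y - x) ^ 2)
    {x : ℝ} (hx : 0 < x) : HasDerivAt (M.choiceMean a) (G x) x := by
  rw [hasDerivAt_iff_isLittleO]
  have h1 : (fun y => M.choiceMean a y - M.choiceMean a x - (y - x) • G x) =O[𝓝 x]
      fun y => (y - x) ^ 2 := by
    refine IsBigO.of_bound K ?_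
    filter_upwards [lt_mem_nhds hx] with y hy
    have := hT x y hx.le hy.le
    rw [Real.norm_eq_abs, Real.norm_eq_abs, abs_of_nonneg (sq_nonneg (y - x)), smul_eq_mul,
      mul_comm (y - x)]
    exact this
  refine h1.trans_isLittleO ?_
  have h2 : Tendsto (fun y => y - x) (𝓝 x) (𝓝 0) := by
    have : Continuous fun y => y - x := by fun_prop
    simpa using this.tendsto x
  have := (isLittleO_pow_id (𝕜 := ℝ) one_lt_two).comp_tendsto h2
  exact this

/-- The derivative of the mean-field supply, by implicit differentiation of the balance
equation. -/
lemma Viable.hasDerivAt_meanFieldSupply (hD : M.DemandAssumption) (hΩ : M.AllocationAssumption)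
    (hf : M.ChoiceAssumption) {a : 𝒜} {p : ℝ} (hp : 0 < p) (hv : M.Viable a p)
    (hpos : ∀ x, 0 < x → 0 < M.allocLim x) {K : ℝ} {G : ℝ → ℝ} (hG0 : ∀ x, 0 ≤ x → 0 ≤ G x)
    (hT : ∀ x y, 0 ≤ x → 0 ≤ y →
      |M.choiceMean a y - M.choiceMean a x - G x * (y - x)| ≤ K * (y - x) ^ 2)
    {μ : ℝ} (hμ : μ = M.meanFieldSupply a p) :
    HasDerivAt (M.meanFieldSupply a)
      (upsilonHat M.allocLim p (M.demandMean a) μ (M.allocLim (M.demandMean a / μ) *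
        G (p * M.allocLim (M.demandMean a / μ)))) p := by
  have hd := hD.mean_pos a
  set d := M.demandMean a
  have hspec := hv.isMeanFieldSupply hD hΩ hf hp
  rw [← hμ] at hspec
  have hμ0 : 0 < μ := hspec.1
  have hx : 0 < d / μ := div_pos hd hμ0
  have hw := hpos _ hx
  set w := M.allocLim (d / μ) with hw_def
  set w' := deriv M.allocLim (d / μ)
  have hw' : 0 ≤ w' := hΩ.regular.deriv_nonneg hx
  set g := G (p * w)
  have hg : 0 ≤ g := hG0 _ (by positivity)
  obtain ⟨L, hL, hLip⟩ := hf.exists_choiceMean_lipschitz a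
  -- One minus the partial derivative in μ of the balance map (p, μ) ↦ F(p ω(d/μ)). The feedback is
  -- negative, so this is positive and the linearised equation is solvable.
  have hone : 0 < 1 + g * p * w' * d / μ ^ 2 := by positivity
  -- the derivative of the balance map
  have hdiv : HasFDerivAt (fun z : ℝ × ℝ => M.allocLim (d / z.2))
      ((w' * (-(d / μ ^ 2))) • ContinuousLinearMap.snd ℝ ℝ ℝ) (p, μ) := by
    have h1 : HasDerivAt (fun m : ℝ => d / m) (-(d / μ ^ 2)) μ := by
      refine ((hasDerivAt_const μ d).div (hasDerivAt_id μ) hμ0.ne').congr_deriv ?_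
      simp [neg_div]
    have h2 : HasDerivAt (fun m : ℝ => M.allocLim (d / m)) (w' * (-(d / μ ^ 2))) μ :=
      (hΩ.regular.hasDerivAt hx).comp μ h1
    exact HasDerivAt.comp_hasFDerivAt (h₂ := fun m : ℝ => M.allocLim (d / m)) (p, μ) h2
      (hasFDerivAt_snd (𝕜 := ℝ) (p := (p, μ)))
  have hprod := (hasFDerivAt_fst (𝕜 := ℝ) (p := (p, μ))).mul hdiv
  have hF : HasDerivAt (M.choiceMean a) g (p * w) := hasDerivAt_choiceMean hT (by positivity)
  have hcomp := hF.comp_hasFDerivAt (p, μ) hprod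
  -- the balance equation along the curve of solutions
  have hev : ∀ᶠ p' in 𝓝 p, M.IsMeanFieldSupply a p' (M.meanFieldSupply a p') ∧ 0 < p' := by
    filter_upwards [hv.eventually hΩ hf hp, lt_mem_nhds hp] with p' h1 h2
    exact ⟨h1.isMeanFieldSupply hD hΩ hf h2, h2⟩
  -- The Lipschitz bound turns the remainder of the Fréchet derivative, little-o of the displacement
  -- in (p, μ), into little-o of p' - p. This replaces the implicit function theorem.
  have hO : (fun p' => (p', M.meanFieldSupply a p') - (p, μ)) =O[𝓝 p] fun p' => p' - p := by
    refine IsBigO.of_bound (max 1 L) ?_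
    filter_upwards [hev] with p' h
    have h1 := hΩ.abs_meanFieldSupply_sub_le hD hf a hLip hL.le hp.le h.2.le hspec h.1
    rw [Prod.mk_sub_mk, Prod.norm_mk, max_le_iff]
    refine ⟨le_mul_of_one_le_left (norm_nonneg _) (le_max_left _ _), h1.trans ?_⟩
    exact mul_le_mul_of_nonneg_right (le_max_right _ _) (abs_nonneg _)
  have htend : Tendsto (fun p' => (p', M.meanFieldSupply a p')) (𝓝 p) (𝓝 (p, μ)) := by
    have h0 : Tendsto (fun p' : ℝ => p' - p) (𝓝 p) (𝓝 0) := by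
      have : Continuous fun y : ℝ => y - p := by fun_prop
      simpa using this.tendsto p
    have := (hO.trans_tendsto h0).add_const (p, μ)
    simpa using this
  have hlit := (hcomp.isLittleO.comp_tendsto htend).trans_isBigO hO
  rw [hasDerivAt_iff_isLittleO, ← hμ]
  have := hlit.const_mul_left (1 + g * p * w' * d / μ ^ 2)⁻¹
  refine this.congr' ?_ .rfl
  filter_upwards [hev] with p' h
  have e1 : M.meanFieldSupply a p'
      = M.choiceMean a (p' * M.allocLim (d / M.meanFieldSupply a p')) := h.1.2.2
  have e2 : μ = M.choiceMean a (p * M.allocLim (d / μ)) := hspec.2.2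
  -- With Δ = w g, the ω in the denominator of Υ̂ cancels; this is where w ≠ 0 is needed.
  have hup : upsilonHat M.allocLim p d μ (w * g) = w * g / (1 + g * p * w' * d / μ ^ 2) := by
    have : p * d * (w * g) * w' / (μ ^ 2 * w) = g * p * w' * d / μ ^ 2 := by
      field_simp
    rw [upsilonHat, this]
  simp only [Function.comp_def, Pi.mul_apply, ← e1, ← e2, hup]
  simp
  field_simp
  ring

/-- The mean-field utility is differentiable at a viable payment, and its derivative is the
population version of the estimator. -/
lemma Viable.hasDerivAt_meanFieldUtility (hD : M.DemandAssumption) (hΩ : M.AllocationAssumption)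
    (hf : M.ChoiceAssumption) (hR : M.RevenueAssumption) {a : 𝒜} {p : ℝ} (hp : 0 < p)
    (hv : M.Viable a p) {K : ℝ} {G : ℝ → ℝ} (hG0 : ∀ x, 0 ≤ x → 0 ≤ G x)
    (hT : ∀ x y, 0 ≤ x → 0 ≤ y →
      |M.choiceMean a y - M.choiceMean a x - G x * (y - x)| ≤ K * (y - x) ^ 2)
    {μ : ℝ} (hμ : μ = M.meanFieldSupply a p) :
    HasDerivAt (M.meanFieldUtility a)
      (gammaHat M.allocLim M.revenueLim p (M.demandMean a) μ (M.allocLim (M.demandMean a / μ) *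
        G (p * M.allocLim (M.demandMean a / μ)))) p := by
  have hd := hD.mean_pos a
  have hspec := hv.isMeanFieldSupply hD hΩ hf hp
  rw [← hμ] at hspec
  have hμ0 : 0 < μ := hspec.1
  have hx : 0 < M.demandMean a / μ := div_pos hd hμ0
  -- If ω vanishes identically, payments have no influence: supply and utility are constant in p,
  -- and Γ̂ is 0 because Δ and ω are.
  rcases hΩ.regular.eq_zero_or_pos with h0 | hpos
  · have hw : M.allocLim (M.demandMean a / μ) = 0 := h0 _ hx.le
    -- `Classical.epsilon` depends on the predicate alone, so equality of predicates gives equal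
    -- supplies at all payments.
    have hsupply : ∀ p' p'', M.IsMeanFieldSupply a p' = M.IsMeanFieldSupply a p'' := by
      intro p' p''
      ext ν
      refine and_congr_right fun hν => and_congr_right fun _ => ?_
      rw [h0 _ (div_pos hd hν).le, mul_zero, mul_zero]
    have hconst : M.meanFieldUtility a
        = fun _ => M.revenueLim (M.demandMean a / μ) * μ := by
      funext p'
      have : M.meanFieldSupply a p' = μ := by
        rw [hμ, meanFieldSupply, meanFieldSupply, hsupply p' p]
      rw [meanFieldUtility, this, hw, mul_zero, sub_zero]
    rw [hconst, hw]
    simpa [gammaHat, upsilonHat, hw] using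
      hasDerivAt_const p (M.revenueLim (M.demandMean a / μ) * μ)
  · have hm := hv.hasDerivAt_meanFieldSupply hD hΩ hf hp hpos hG0 hT hμ
    set d := M.demandMean a
    set w := M.allocLim (d / μ) with hw_def
    set U := upsilonHat M.allocLim p d μ (w * G (p * w)) with hU
    have hquot : HasDerivAt (fun p' => d / M.meanFieldSupply a p') (-(d * U) / μ ^ 2) p := by
      have := (hasDerivAt_const p d).div hm (by rw [← hμ]; exact hμ0.ne')
      rw [← hμ] at this
      exact this.congr_deriv (by ring)
    have hr : HasDerivAt (fun p' => M.revenueLim (d / M.meanFieldSupply a p'))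
        (deriv M.revenueLim (d / μ) * (-(d * U) / μ ^ 2)) p := by
      refine HasDerivAt.comp p ?_ hquot
      rw [← hμ]
      exact hR.smooth.hasDerivAt_of_pos hx
    have ho : HasDerivAt (fun p' => M.allocLim (d / M.meanFieldSupply a p'))
        (deriv M.allocLim (d / μ) * (-(d * U) / μ ^ 2)) p := by
      refine HasDerivAt.comp p ?_ hquot
      rw [← hμ]
      exact hΩ.regular.hasDerivAt hx
    have := (hr.sub ((hasDerivAt_id p).mul ho)).mul hm
    refine (this.congr_deriv ?_)
    simp only [Pi.sub_apply, Pi.mul_apply, id, ← hμ, gammaHat]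
    rw [← hw_def, ← hU]
    field_simp
    ring

end Market

/-! ### Sample means -/

/-- Chebyshev's inequality for the mean of independent variables bounded by `1`. -/
lemma measureReal_sampleMean_deviation_le {Ω : Type*} [MeasurableSpace Ω] {P : Measure Ω}
    [IsProbabilityMeasure P] {n : ℕ} (hn : 0 < n) {W : Fin n → Ω → ℝ}
    (hW : ∀ i, Measurable (W i)) (hindep : iIndepFun W P)
    (hbd : ∀ i, ∀ᵐ ω ∂P, W i ω ∈ Set.Icc (-1 : ℝ) 1) {m : ℝ} (hm : ∀ i, ∫ ω, W i ω ∂P = m)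
    {c : ℝ} (hc : 0 < c) :
    P.real {ω | c ≤ |sampleMean (fun i => W i ω) - m|} ≤ 1 / (n * c ^ 2) := by
  have hn' : (0 : ℝ) < n := Nat.cast_pos.2 hn
  have hLp : ∀ i, MemLp (W i) 2 P := fun i => memLp_of_bounded (hbd i)
    (hW i).aestronglyMeasurable 2
  have hvar : variance (∑ i, W i) P ≤ n := by
    rw [IndepFun.variance_sum (fun i _ => hLp i) fun i _ j _ hij => hindep.indepFun hij]
    calc ∑ i, variance (W i) P ≤ ∑ _i : Fin n, (1 : ℝ) := Finset.sum_le_sum fun i _ => by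
          -- The squared half-length of [-1, 1] is 1.
          have := variance_le_sq_of_bounded (hbd i) (hW i).aemeasurable
          norm_num at this
          exact this
      _ = n := by simp
  have hmean : ∫ ω, (∑ i, W i) ω ∂P = n * m := by
    simp_rw [Finset.sum_apply]
    rw [integral_finsetSum _ fun i _ => (hLp i).integrable one_le_two]
    simp [hm]
  have hset : {ω | c ≤ |sampleMean (fun i => W i ω) - m|}
      = {ω | n * c ≤ |(∑ i, W i) ω - ∫ ω, (∑ i, W i) ω ∂P|} := by
    ext ω
    rw [Set.mem_ofPred_eq, Set.mem_ofPred_eq, hmean, Finset.sum_apply, sampleMean,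
      div_sub' hn'.ne', abs_div, abs_of_pos hn', le_div_iff₀ hn', mul_comm c]
  rw [hset]
  have := meas_ge_le_variance_div_sq (memLp_finsetSum' Finset.univ fun i _ => hLp i)
    (mul_pos hn' hc)
  calc P.real _ ≤ variance (∑ i, W i) P / (n * c) ^ 2 :=
        ENNReal.toReal_le_of_le_ofReal (div_nonneg (variance_nonneg _ _) (sq_nonneg _)) this
    _ ≤ n / (n * c) ^ 2 := by gcongr
    _ = 1 / (n * c ^ 2) := by field_simp

/-! ### The law of a period in a given state -/

/-- Makes constant payments the case z = 0, so that the same estimates serve the limit of the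
utilities and the estimator. -/
lemma perturbedPayment_zero (p : ℝ) : perturbedPayment p 0 = Measure.dirac p := by
  rw [perturbedPayment, add_zero, sub_zero, ← add_smul, ENNReal.inv_two_add_inv_two, one_smul]

lemma perturbedPayment_prod {ℬ : Type*} [MeasurableSpace ℬ] (p z : ℝ) (β : Measure ℬ)
    [IsProbabilityMeasure β] : (perturbedPayment p z).prod β
      = (2⁻¹ : ENNReal) • β.map (Prod.mk (p + z)) + (2⁻¹ : ENNReal) • β.map (Prod.mk (p - z)) := by
  have h : ∀ x : ℝ, SFinite ((2⁻¹ : ENNReal) • Measure.dirac x) := fun x => inferInstance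
  rw [perturbedPayment, Measure.add_prod, Measure.prod_smul_left, Measure.prod_smul_left,
    Measure.dirac_prod, Measure.dirac_prod]

namespace EquilibriumPeriod

variable {𝒜 : Type v} {ℬ : Type w} [MeasurableSpace 𝒜] [MeasurableSpace ℬ]
  {M : Market 𝒜 ℬ} {n : ℕ} {π : Measure ℝ}

/-- The conditional probability given the global state. -/
noncomputable abbrev law (X : EquilibriumPeriod.{u} M n π) (a : 𝒜) : Measure X.Sample :=
  X.Pr[|X.A ⁻¹' {a}]

/-- The expected allocation `E[Ω(D, T) | A = a]` to an active supplier. -/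
noncomputable def expectedAlloc (X : EquilibriumPeriod.{u} M n π) (a : 𝒜) : ℝ :=
  ∫ ω, M.alloc (X.D ω) (∑ j, X.Z j ω) ∂X.law a

variable (X : EquilibriumPeriod.{u} M n π) {a : 𝒜}

lemma isProbabilityMeasure_law (ha : X.Pr (X.A ⁻¹' {a}) ≠ 0) : IsProbabilityMeasure (X.law a) :=
  cond_isProbabilityMeasure ha

lemma Z_mem_Icc (i : Fin n) (ω : X.Sample) : X.Z i ω ∈ Set.Icc (0 : ℝ) 1 := by
  rcases X.Z_eq i ω with h | h <;> simp [h]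

lemma sum_Z_nonneg (ω : X.Sample) : 0 ≤ ∑ j, X.Z j ω :=
  Finset.sum_nonneg fun i _ => (X.Z_mem_Icc i ω).1

lemma sum_Z_le (ω : X.Sample) : ∑ j, X.Z j ω ≤ n := by
  calc ∑ j, X.Z j ω ≤ ∑ _j : Fin n, (1 : ℝ) := Finset.sum_le_sum fun i _ => (X.Z_mem_Icc i ω).2
    _ = n := by simp

lemma natCast_floor_sum_Z (ω : X.Sample) : ((⌊∑ j, X.Z j ω⌋₊ : ℕ) : ℝ) = ∑ j, X.Z j ω := by
  have : ∃ k : ℕ, ∑ j, X.Z j ω = k := by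
    have h : ∀ j, ∃ k : ℕ, X.Z j ω = k := fun j => by
      rcases X.Z_eq j ω with h | h
      · exact ⟨0, by simp [h]⟩
      · exact ⟨1, by simp [h]⟩
    choose k hk using h
    exact ⟨∑ j, k j, by simp [hk]⟩
  obtain ⟨k, hk⟩ := this
  rw [hk, Nat.floor_natCast]

lemma measurable_sum_Z : Measurable fun ω => ∑ j, X.Z j ω :=
  Finset.measurable_sum _ fun i _ => X.measurable_Z i

/-- Functions of demand and supply that are measurable in demand are random variables. -/
lemma measurable_demand_supply {g : ℝ → ℝ → ℝ} (hg : ∀ t, Measurable fun d => g d t) :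
    Measurable fun ω => g (X.D ω) (∑ j, X.Z j ω) := by
  -- Supply takes values in the countable set ℕ, so measurability of the sections is enough for
  -- joint measurability.
  have h : Measurable fun y : ℝ × ℕ => g y.1 y.2 :=
    measurable_from_prod_countable_left fun k => hg k
  have := h.comp (X.measurable_D.prodMk (Nat.measurable_floor.comp X.measurable_sum_Z))
  simpa [Function.comp_def, X.natCast_floor_sum_Z] using this

lemma ae_D_nonneg (hD : M.DemandAssumption) (ha : X.Pr (X.A ⁻¹' {a}) ≠ 0) :
    ∀ᵐ ω ∂X.law a, 0 ≤ X.D ω := by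
  have := hD.nonneg n a
  rw [← X.law_D a ha] at this
  exact ae_of_ae_map X.measurable_D.aemeasurable this

end EquilibriumPeriod

lemma Market.AllocationAssumption.exists_alloc_bound {𝒜 : Type v} {ℬ : Type w}
    [MeasurableSpace ℬ] {M : Market 𝒜 ℬ} (hΩ : M.AllocationAssumption) :
    ∃ C, 0 < C ∧ ∀ d t, 0 ≤ d → 0 ≤ t → M.alloc d t ≤ C := by
  obtain ⟨C, hC⟩ := hΩ.bounded_zero
  refine ⟨max C 1, by positivity, fun d t hd ht => ?_⟩
  exact (hΩ.anti_supply d hd (Set.mem_Ici.2 le_rfl) ht ht).trans ((hC d hd).trans (le_max_left _ _))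

namespace EquilibriumPeriod

variable {𝒜 : Type v} {ℬ : Type w} [MeasurableSpace 𝒜] [MeasurableSpace ℬ]
  {M : Market 𝒜 ℬ} {n : ℕ} {π : Measure ℝ} (X : EquilibriumPeriod.{u} M n π) {a : 𝒜}

/-- Sections in demand are measurable because they are monotone. Truncating at 0 makes them monotone
on the whole line and changes nothing almost surely. -/
lemma aestronglyMeasurable_alloc (hD : M.DemandAssumption) (hΩ : M.AllocationAssumption)
    (ha : X.Pr (X.A ⁻¹' {a}) ≠ 0) :
    AEStronglyMeasurable (fun ω => M.alloc (X.D ω) (∑ j, X.Z j ω)) (X.law a) := by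
  have hmeas : Measurable fun ω => M.alloc (max (X.D ω) 0) (max (∑ j, X.Z j ω) 0) := by
    refine X.measurable_demand_supply (g := fun d t => M.alloc (max d 0) (max t 0)) fun t => ?_
    exact Monotone.measurable fun d d' hdd' => hΩ.mono_demand _ (le_max_right _ _)
      (Set.mem_Ici.2 (le_max_right _ _)) (Set.mem_Ici.2 (le_max_right _ _))
      (max_le_max_right 0 hdd')
  refine hmeas.aestronglyMeasurable.congr ?_
  filter_upwards [X.ae_D_nonneg hD ha] with ω hω
  rw [max_eq_left hω, max_eq_left (X.sum_Z_nonneg ω)]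

lemma integrable_alloc (hD : M.DemandAssumption) (hΩ : M.AllocationAssumption)
    (ha : X.Pr (X.A ⁻¹' {a}) ≠ 0) :
    Integrable (fun ω => M.alloc (X.D ω) (∑ j, X.Z j ω)) (X.law a) := by
  have := X.isProbabilityMeasure_law ha
  obtain ⟨C, -, hC⟩ := hΩ.exists_alloc_bound
  refine Integrable.of_bound (X.aestronglyMeasurable_alloc hD hΩ ha) C ?_
  filter_upwards [X.ae_D_nonneg hD ha] with ω hω
  rw [Real.norm_eq_abs, abs_of_nonneg (hΩ.nonneg _ _ hω (X.sum_Z_nonneg ω))]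
  exact hC _ _ hω (X.sum_Z_nonneg ω)

lemma expectedAlloc_nonneg (hD : M.DemandAssumption) (hΩ : M.AllocationAssumption)
    (ha : X.Pr (X.A ⁻¹' {a}) ≠ 0) : 0 ≤ X.expectedAlloc a := by
  refine integral_nonneg_of_ae ?_
  filter_upwards [X.ae_D_nonneg hD ha] with ω hω
  exact hΩ.nonneg _ _ hω (X.sum_Z_nonneg ω)

lemma expectedAlloc_le (hD : M.DemandAssumption) (hΩ : M.AllocationAssumption)
    (ha : X.Pr (X.A ⁻¹' {a}) ≠ 0) {C : ℝ} (hC : ∀ d t, 0 ≤ d → 0 ≤ t → M.alloc d t ≤ C) :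
    X.expectedAlloc a ≤ C := by
  have := X.isProbabilityMeasure_law ha
  calc X.expectedAlloc a ≤ ∫ _, C ∂X.law a := by
        refine integral_mono_ae (X.integrable_alloc hD hΩ ha) (integrable_const _) ?_
        filter_upwards [X.ae_D_nonneg hD ha] with ω hω
        exact hC _ _ hω (X.sum_Z_nonneg ω)
    _ = C := by simp

/-- Payments take the values `p + z` and `p - z` only. -/
lemma ae_P_eq (hf : M.ChoiceAssumption) (ha : X.Pr (X.A ⁻¹' {a}) ≠ 0) {p z : ℝ}
    (hπ : π = perturbedPayment p z) (i : Fin n) :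
    ∀ᵐ ω ∂X.law a, X.P i ω = p + z ∨ X.P i ω = p - z := by
  have hβ := hf.isProb a
  have hm : MeasurableSet {y : ℝ × ℬ | y.1 = p + z ∨ y.1 = p - z} :=
    (measurable_fst (measurableSet_singleton (p + z))).union
      (measurable_fst (measurableSet_singleton (p - z)))
  have h : ∀ᵐ y ∂π.prod (M.featureLaw a), y.1 = p + z ∨ y.1 = p - z := by
    rw [hπ, perturbedPayment_prod, ae_add_measure_iff]
    constructor
    all_goals
      refine Measure.ae_smul_measure ?_ _
      rw [ae_map_iff measurable_prodMk_left.aemeasurable hm]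
      simp
  rw [← X.law_PB a ha i] at h
  exact ae_of_ae_map ((X.measurable_P i).prodMk (X.measurable_B i)).aemeasurable h

/-- Means of functions of the payment and the feature of a supplier. -/
lemma integral_payment_feature (hf : M.ChoiceAssumption) (ha : X.Pr (X.A ⁻¹' {a}) ≠ 0) {p z : ℝ}
    (hπ : π = perturbedPayment p z) {h : ℝ × ℬ → ℝ} (hh : Measurable h)
    (hi₁ : Integrable (fun b => h (p + z, b)) (M.featureLaw a))
    (hi₂ : Integrable (fun b => h (p - z, b)) (M.featureLaw a)) (i : Fin n) :
    ∫ ω, h (X.P i ω, X.B i ω) ∂X.law a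
      = (∫ b, h (p + z, b) ∂M.featureLaw a + ∫ b, h (p - z, b) ∂M.featureLaw a) / 2 := by
  have hβ := hf.isProb a
  have hPB : Measurable fun ω => (X.P i ω, X.B i ω) :=
    (X.measurable_P i).prodMk (X.measurable_B i)
  have hne : (2⁻¹ : ENNReal) ≠ ⊤ := by simp
  rw [← integral_map hPB.aemeasurable hh.aestronglyMeasurable, X.law_PB a ha i, hπ,
    perturbedPayment_prod, integral_add_measure, integral_smul_measure, integral_smul_measure,
    integral_map measurable_prodMk_left.aemeasurable hh.aestronglyMeasurable,
    integral_map measurable_prodMk_left.aemeasurable hh.aestronglyMeasurable]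
  · simp
    ring
  · refine Integrable.smul_measure ?_ hne
    exact (integrable_map_measure hh.aestronglyMeasurable
      measurable_prodMk_left.aemeasurable).2 hi₁
  · refine Integrable.smul_measure ?_ hne
    exact (integrable_map_measure hh.aestronglyMeasurable
      measurable_prodMk_left.aemeasurable).2 hi₂

/-- The mean of `Z_i g(P_i)` in equilibrium. -/
lemma integral_Z_mul (hD : M.DemandAssumption) (hΩ : M.AllocationAssumption)
    (hf : M.ChoiceAssumption) (ha : X.Pr (X.A ⁻¹' {a}) ≠ 0) {p z : ℝ}
    (hπ : π = perturbedPayment p z) (hz : 0 ≤ z) (hzp : z ≤ p) {g : ℝ → ℝ} (hg : Measurable g)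
    (i : Fin n) :
    ∫ ω, X.Z i ω * g (X.P i ω) ∂X.law a
      = (M.choiceMean a ((p + z) * X.expectedAlloc a) * g (p + z)
        + M.choiceMean a ((p - z) * X.expectedAlloc a) * g (p - z)) / 2 := by
  have hprob := X.isProbabilityMeasure_law ha
  have hβ := hf.isProb a
  have hq := X.expectedAlloc_nonneg hD hΩ ha
  set q := X.expectedAlloc a with hq_def
  have hplus : 0 ≤ (p + z) * q := mul_nonneg (by linarith) hq
  have hminus : 0 ≤ (p - z) * q := mul_nonneg (by linarith) hq
  have hP := X.ae_P_eq hf ha hπ i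
  have hPB : Measurable fun ω => (X.P i ω, X.B i ω) :=
    (X.measurable_P i).prodMk (X.measurable_B i)
  have hZ : Integrable (X.Z i) (X.law a) :=
    Integrable.of_bound (X.measurable_Z i).aestronglyMeasurable 1 (.of_forall fun ω => by
      have := X.Z_mem_Icc i ω
      rw [Real.norm_eq_abs, abs_of_nonneg this.1]; exact this.2)
  have hgP : Measurable fun ω => g (X.P i ω) := hg.comp (X.measurable_P i)
  have hbound : ∀ᵐ ω ∂X.law a, |g (X.P i ω)| ≤ max |g (p + z)| |g (p - z)| := by
    filter_upwards [hP] with ω hω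
    rcases hω with h | h <;> rw [h]
    · exact le_max_left _ _
    · exact le_max_right _ _
  have hZg : Integrable (X.Z i * fun ω => g (X.P i ω)) (X.law a) := by
    refine Integrable.of_bound ((X.measurable_Z i).mul hgP).aestronglyMeasurable
      (max |g (p + z)| |g (p - z)|) ?_
    filter_upwards [hbound] with ω hω
    have := X.Z_mem_Icc i ω
    rw [Pi.mul_apply, norm_mul, Real.norm_eq_abs, abs_of_nonneg this.1]
    exact (mul_le_of_le_one_left (norm_nonneg _) this.2).trans hω
  set m := MeasurableSpace.comap (fun ω => (X.P i ω, X.B i ω)) inferInstance with hm_def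
  have hm : m ≤ X.measurableSpace := hPB.comap_le
  have hgPm : StronglyMeasurable[m] fun ω => g (X.P i ω) := by
    have : Measurable[m] fun ω => (X.P i ω, X.B i ω) := comap_measurable _
    exact ((hg.comp measurable_fst).comp this).stronglyMeasurable
  -- The choice functions are measurable in b for each fixed argument only. As the payment has two
  -- values, it can be replaced by constants inside them, which makes h jointly measurable.
  set h : ℝ × ℬ → ℝ := fun y =>
    (if y.1 = p + z then M.choice y.2 ((p + z) * q) else M.choice y.2 ((p - z) * q)) * g y.1
    with hh_def
  have hh : Measurable h :=
    (Measurable.ite (measurable_fst (measurableSet_singleton (p + z)))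
      ((hf.measurable _ hplus).comp measurable_snd)
      ((hf.measurable _ hminus).comp measurable_snd)).mul (hg.comp measurable_fst)
  have hplus_eq : ∀ b, h (p + z, b) = M.choice b ((p + z) * q) * g (p + z) := fun b => by
    simp [hh_def]
  -- For z = 0 the two payments coincide and the first branch of h is taken.
  have hminus_eq : ∀ b, h (p - z, b) = M.choice b ((p - z) * q) * g (p - z) := fun b => by
    simp only [hh_def]
    split_ifs with hcase
    · rw [hcase]
    · rfl
  have hstep : ∫ ω, X.Z i ω * g (X.P i ω) ∂X.law a
      = ∫ ω, h (X.P i ω, X.B i ω) ∂X.law a := by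
    calc ∫ ω, X.Z i ω * g (X.P i ω) ∂X.law a
        = ∫ ω, ((X.law a)[X.Z i * fun ω => g (X.P i ω) | m]) ω ∂X.law a :=
          (integral_condExp hm).symm
      _ = ∫ ω, h (X.P i ω, X.B i ω) ∂X.law a := by
          refine integral_congr_ae ?_
          filter_upwards [condExp_mul_of_stronglyMeasurable_right hgPm hZg hZ,
            X.choice_eq a ha i, hP] with ω h1 h2 h3
          rw [h1, Pi.mul_apply, h2]
          change M.choice (X.B i ω) (X.P i ω * q) * g (X.P i ω) = _
          rcases h3 with h3 | h3 <;> rw [h3]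
          · rw [hplus_eq]
          · rw [hminus_eq]
  have hi1 : Integrable (fun b => h (p + z, b)) (M.featureLaw a) := by
    simp_rw [hplus_eq]
    exact (hf.integrable_choice a hplus).mul_const _
  have hi2 : Integrable (fun b => h (p - z, b)) (M.featureLaw a) := by
    simp_rw [hminus_eq]
    exact (hf.integrable_choice a hminus).mul_const _
  rw [hstep, X.integral_payment_feature hf ha hπ hh hi1 hi2 i]
  simp_rw [hplus_eq, hminus_eq, integral_mul_const]
  rfl

/-- The amount served by supplier `i` has the mean of the allocation to `i`. -/
lemma integrable_Z_mul_S [MeasurableSingletonClass 𝒜] (ha : X.Pr (X.A ⁻¹' {a}) ≠ 0)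
    (i : Fin n) :
    Integrable (fun ω => X.Z i ω * X.S i ω) (X.law a) ∧
    ∫ ω, X.Z i ω * X.S i ω ∂X.law a
      = ∫ ω, X.Z i ω * M.alloc (X.D ω) (∑ j, X.Z j ω) ∂X.law a := by
  have hprob := X.isProbabilityMeasure_law ha
  have hA : MeasurableSet (X.A ⁻¹' {a}) := X.measurable_A (measurableSet_singleton a)
  set s := X.Z i ⁻¹' {1} with hs_def
  have hs : MeasurableSet s := X.measurable_Z i (measurableSet_singleton 1)
  have hind : ∀ f : X.Sample → ℝ, (fun ω => X.Z i ω * f ω) = s.indicator f := by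
    intro f
    funext ω
    rcases X.Z_eq i ω with h | h
    · rw [h, zero_mul, Set.indicator_of_notMem]
      simp [hs_def, h]
    · rw [h, one_mul, Set.indicator_of_mem]
      simp [hs_def, h]
  have hcond : X.Pr[|X.A ⁻¹' {a} ∩ s] = (X.law a)[|s] :=
    (cond_cond_eq_cond_inter hA hs X.Pr).symm
  rw [hind, hind, integrable_indicator_iff hs, integral_indicator hs, integral_indicator hs]
  -- If supplier i is almost surely inactive, both integrals vanish and conditioning on activity
  -- says nothing.
  by_cases h0 : X.law a s = 0
  · have hr : (X.law a).restrict s = 0 := Measure.restrict_eq_zero.2 h0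
    rw [IntegrableOn, hr]
    simp
  have hc0 : (X.law a s)⁻¹ ≠ 0 := ENNReal.inv_ne_zero.2 (measure_ne_top _ _)
  have hct : (X.law a s)⁻¹ ≠ ⊤ := ENNReal.inv_ne_top.2 h0
  have hSi := X.integrable_S a i
  have hSe := X.alloc_eq a i
  rw [hcond] at hSi hSe
  have hprob' : IsProbabilityMeasure ((X.law a)[|s]) := cond_isProbabilityMeasure h0
  have hDT : Measurable fun ω => (X.D ω, ∑ j, X.Z j ω) :=
    X.measurable_D.prodMk X.measurable_sum_Z
  refine ⟨(integrable_smul_measure hc0 hct).1 hSi, ?_⟩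
  have h1 := (integral_condExp (f := X.S i) (μ := (X.law a)[|s]) hDT.comap_le).symm.trans
    (integral_congr_ae hSe)
  -- Both conditional means carry the normalising factor 1 / P(Z_i = 1 | A = a), which is cancelled.
  rw [ProbabilityTheory.cond, integral_smul_measure, integral_smul_measure] at h1
  exact smul_right_injective ℝ (ENNReal.toReal_ne_zero.2 ⟨hc0, hct⟩) h1

/-- The expected utility when all payments equal `p`. -/
lemma utility_eq [MeasurableSingletonClass 𝒜] (hD : M.DemandAssumption)
    (hΩ : M.AllocationAssumption) (hf : M.ChoiceAssumption) (ha : X.Pr (X.A ⁻¹' {a}) ≠ 0)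
    {p : ℝ} (hπ : π = Measure.dirac p)
    (hint : Integrable (fun ω => M.revenue (X.D ω) (∑ j, X.Z j ω)) (X.law a)) :
    X.utility a = ∫ ω, (M.revenue (X.D ω) (∑ j, X.Z j ω)
      - p * (∑ j, X.Z j ω) * M.alloc (X.D ω) (∑ j, X.Z j ω)) / n ∂X.law a := by
  have hP : ∀ᵐ ω ∂X.law a, ∀ i, X.P i ω = p := by
    rw [ae_all_iff]
    intro i
    filter_upwards [X.ae_P_eq hf ha (hπ.trans (perturbedPayment_zero p).symm) i] with ω hω
    simpa using hω
  have hZA : ∀ i, Integrable (fun ω => X.Z i ω * M.alloc (X.D ω) (∑ j, X.Z j ω)) (X.law a) :=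
    fun i => (X.integrable_alloc hD hΩ ha).bdd_mul (c := 1)
      (X.measurable_Z i).aestronglyMeasurable (.of_forall fun ω => by
        have := X.Z_mem_Icc i ω
        rw [Real.norm_eq_abs, abs_of_nonneg this.1]; exact this.2)
  have h1 : ∀ ω, p * (∑ j, X.Z j ω) * M.alloc (X.D ω) (∑ j, X.Z j ω)
      = ∑ i, p * (X.Z i ω * M.alloc (X.D ω) (∑ j, X.Z j ω)) := fun ω => by
    rw [mul_assoc, Finset.sum_mul, Finset.mul_sum]
  have h2 : (fun ω => M.revenue (X.D ω) (∑ j, X.Z j ω) - ∑ i, X.P i ω * X.Z i ω * X.S i ω)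
      =ᵐ[X.law a] fun ω => M.revenue (X.D ω) (∑ j, X.Z j ω)
        - ∑ i, p * (X.Z i ω * X.S i ω) := by
    filter_upwards [hP] with ω hω
    simp only [hω, mul_assoc]
  rw [utility, integral_congr_ae h2, integral_div,
    integral_sub hint (integrable_finsetSum _ fun i _ =>
      ((X.integrable_Z_mul_S ha i).1.const_mul p)),
    integral_finsetSum _ fun i _ => ((X.integrable_Z_mul_S ha i).1.const_mul p)]
  simp_rw [h1]
  rw [integral_sub hint (integrable_finsetSum _ fun i _ => ((hZA i).const_mul p)),
    integral_finsetSum _ fun i _ => ((hZA i).const_mul p)]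
  simp_rw [integral_const_mul, (X.integrable_Z_mul_S ha _).2]
  ring

end EquilibriumPeriod

/-! ### Error functions -/

lemma IsErrorFunction.exists_abs_le {l : ℝ → ℝ → ℝ} (h : IsErrorFunction l) {η : ℝ}
    (hη : 0 < η) : ∃ N, ∀ d t, N ≤ d → N ≤ t → |l d t| ≤ η := by
  have hlim : Tendsto (fun x : ℝ × ℝ => 1 / √x.2 + 1 / √x.1) (atTop ×ˢ atTop) (𝓝 0) := by
    have h0 : Tendsto (fun y : ℝ => 1 / √y) atTop (𝓝 0) := by
      simpa [Function.comp_def] using tendsto_inv_atTop_zero.comp Real.tendsto_sqrt_atTop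
    simpa using (h0.comp tendsto_snd).add (h0.comp tendsto_fst)
  have hl := h.isLittleO.trans_tendsto hlim
  rw [prod_atTop_atTop_eq] at hl
  have := hl.eventually (Metric.ball_mem_nhds 0 hη)
  obtain ⟨⟨N₁, N₂⟩, hN⟩ := eventually_atTop.1 this
  refine ⟨max N₁ N₂, fun d t hd ht => ?_⟩
  have := hN (d, t) ⟨(le_max_left _ _).trans hd, (le_max_right _ _).trans ht⟩
  simpa using this.le

namespace Market

variable {𝒜 : Type v} {ℬ : Type w} [MeasurableSpace ℬ] {M : Market 𝒜 ℬ}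

/-- Scaling demand and supply together fixes their ratio, so only the vanishing error term depends
on n. -/
lemma AllocationAssumption.tendsto_alloc (hΩ : M.AllocationAssumption) {x z : ℝ} (hx : 0 < x)
    (hz : 0 < z) :
    Tendsto (fun n : ℕ => M.alloc (n * x) (n * z)) atTop (𝓝 (M.allocLim (x / z))) := by
  obtain ⟨l, hl, happ⟩ := hΩ.approx
  rw [Metric.tendsto_atTop']
  intro η hη
  obtain ⟨N, hN⟩ := hl.exists_abs_le (half_pos hη)
  have hxt : Tendsto (fun n : ℕ => (n : ℝ) * x) atTop atTop :=
    tendsto_natCast_atTop_atTop.atTop_mul_const hx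
  have hzt : Tendsto (fun n : ℕ => (n : ℝ) * z) atTop atTop :=
    tendsto_natCast_atTop_atTop.atTop_mul_const hz
  obtain ⟨n₀, hn₀⟩ := eventually_atTop.1 ((hxt.eventually_ge_atTop N).and
    (hzt.eventually_ge_atTop N))
  refine ⟨n₀, fun n hn => ?_⟩
  have hnpos : (0 : ℝ) < n := Nat.cast_pos.2 (by omega)
  have h := hN _ _ (hn₀ n hn.le).1 (hn₀ n hn.le).2
  rw [happ _ _ (by positivity) (by positivity), mul_div_mul_left _ _ hnpos.ne', Real.dist_eq,
    add_sub_cancel_left]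
  linarith

/-- Revenue grows at most linearly. -/
lemma RevenueAssumption.exists_bound (hR : M.RevenueAssumption) :
    ∃ C, 0 ≤ C ∧ ∀ d t, 0 ≤ d → 0 ≤ t → |M.revenue d t| ≤ C * (d + t) := by
  obtain ⟨C, hC⟩ := hR.deriv_bounded
  obtain ⟨l, hl, happ⟩ := hR.approx
  obtain ⟨Cl, hCl⟩ := hl.bounded
  have hC0 : 0 ≤ C := (abs_nonneg _).trans (hC 1 one_pos)
  have hCl0 : 0 ≤ Cl := (abs_nonneg _).trans (hCl 0 0 le_rfl le_rfl)
  set r := M.revenueLim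
  -- The derivative bound gives linear growth on (0, ∞) only. The term |r 0| covers x = 0, where r
  -- need not be continuous.
  have hr : ∀ x, 0 ≤ x → |r x| ≤ |r 0| + |r 1| + C * (x + 1) := by
    intro x hx
    rcases hx.eq_or_lt with rfl | hx
    · have := abs_nonneg (r 1); nlinarith
    · have := (convex_Ioi (0 : ℝ)).norm_image_sub_le_of_norm_deriv_le (f := r) (C := C)
        (fun y hy => (hR.smooth.hasDerivAt_of_pos hy).differentiableAt) (fun y hy => hC y hy)
        (Set.mem_Ioi.2 one_pos) (Set.mem_Ioi.2 hx)
      rw [Real.norm_eq_abs, Real.norm_eq_abs] at this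
      have h1 : |x - 1| ≤ x + 1 := by rw [abs_le]; constructor <;> linarith
      have h2 : |r x| ≤ |r 1| + |r x - r 1| := by
        have := abs_add_le (r 1) (r x - r 1)
        rwa [add_sub_cancel] at this
      have h3 : C * |x - 1| ≤ C * (x + 1) := mul_le_mul_of_nonneg_left h1 hC0
      linarith [abs_nonneg (r 0)]
  refine ⟨|r 0| + |r 1| + C + Cl, by positivity, fun d t hd ht => ?_⟩
  rcases ht.eq_or_lt with rfl | ht
  · rw [hR.zero_supply d hd, abs_zero]; positivity
  rw [happ d t hd ht, abs_mul, abs_of_pos ht]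
  have h1 := hr (d / t) (div_nonneg hd ht.le)
  have h2 := hCl d t hd ht.le
  have h3 : |r (d / t) - l d t| ≤ |r 0| + |r 1| + C * (d / t + 1) + Cl :=
    (abs_sub _ _).trans (add_le_add h1 h2)
  calc |r (d / t) - l d t| * t ≤ (|r 0| + |r 1| + C * (d / t + 1) + Cl) * t :=
        mul_le_mul_of_nonneg_right h3 ht.le
    _ = (|r 0| + |r 1| + C + Cl) * t + C * d := by field_simp; ring
    _ ≤ (|r 0| + |r 1| + C + Cl) * t + (|r 0| + |r 1| + C + Cl) * d := by
        gcongr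
        linarith [abs_nonneg (r 0), abs_nonneg (r 1)]
    _ = _ := by ring

end Market

/-! ### Concentration of demand and supply -/

namespace EquilibriumPeriod

variable {𝒜 : Type v} {ℬ : Type w} [MeasurableSpace 𝒜] [MeasurableSpace ℬ]
  {M : Market 𝒜 ℬ}

/-- Relative demand converges in mean square, uniformly over all periods. -/
lemma eventually_integral_sq_demand_le (hD : M.DemandAssumption) (a : 𝒜) {θ : ℝ} (hθ : 0 < θ) :
    ∀ᶠ n : ℕ in atTop, ∀ (π : Measure ℝ) (X : EquilibriumPeriod.{u} M n π),
      X.Pr (X.A ⁻¹' {a}) ≠ 0 →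
      Integrable (fun ω => (X.D ω / n - M.demandMean a) ^ 2) (X.law a) ∧
      ∫ ω, (X.D ω / n - M.demandMean a) ^ 2 ∂X.law a ≤ θ := by
  have h := (hD.concentrates a).eventually_lt_const (ENNReal.ofReal_pos.2 hθ)
  filter_upwards [h] with n hn π X ha
  have hmeas : Measurable fun x : ℝ => (x / n - M.demandMean a) ^ 2 := by fun_prop
  rw [← X.law_D a ha, lintegral_map hmeas.ennreal_ofReal X.measurable_D] at hn
  have hm : AEStronglyMeasurable (fun ω => (X.D ω / n - M.demandMean a) ^ 2) (X.law a) :=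
    (hmeas.comp X.measurable_D).aestronglyMeasurable
  have hnn : 0 ≤ᵐ[X.law a] fun ω => (X.D ω / n - M.demandMean a) ^ 2 :=
    .of_forall fun ω => sq_nonneg _
  refine ⟨(lintegral_ofReal_ne_top_iff_integrable hm hnn).1 (hn.trans ENNReal.ofReal_lt_top).ne,
    ?_⟩
  rw [integral_eq_lintegral_of_nonneg_ae hnn hm]
  exact ENNReal.toReal_le_of_le_ofReal hθ.le hn.le

/-- Relative demand converges in probability, uniformly over all periods. -/
lemma eventually_demand_deviation_le (hD : M.DemandAssumption) (a : 𝒜) {ρ θ : ℝ} (hρ : 0 < ρ)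
    (hθ : 0 < θ) :
    ∀ᶠ n : ℕ in atTop, ∀ (π : Measure ℝ) (X : EquilibriumPeriod.{u} M n π),
      X.Pr (X.A ⁻¹' {a}) ≠ 0 →
      (X.law a).real {ω | ρ ≤ |X.D ω / n - M.demandMean a|} ≤ θ := by
  filter_upwards [eventually_integral_sq_demand_le hD a (θ := ρ ^ 2 * θ) (by positivity)]
    with n hn π X ha
  obtain ⟨hi, hle⟩ := hn π X ha
  have := mul_meas_ge_le_integral_of_nonneg (.of_forall fun ω => sq_nonneg _) hi (ρ ^ 2)
  have hset : {ω | ρ ≤ |X.D ω / n - M.demandMean a|}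
      = {ω | ρ ^ 2 ≤ (X.D ω / n - M.demandMean a) ^ 2} := by
    ext ω
    rw [Set.mem_ofPred_eq, Set.mem_ofPred_eq, sq_le_sq, abs_of_pos hρ]
  rw [hset]
  exact le_of_mul_le_mul_left (this.trans hle) (by positivity)

section

variable {n : ℕ} {π : Measure ℝ} (X : EquilibriumPeriod.{u} M n π) {a : 𝒜}

/-- Upper bound on the expected allocation, by monotonicity. -/
lemma expectedAlloc_le_add (hD : M.DemandAssumption) (hΩ : M.AllocationAssumption)
    (ha : X.Pr (X.A ⁻¹' {a}) ≠ 0) {C : ℝ} (hC0 : 0 ≤ C)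
    (hC : ∀ d t, 0 ≤ d → 0 ≤ t → M.alloc d t ≤ C) {x z : ℝ} (hx : 0 ≤ x) (hz : 0 ≤ z) :
    X.expectedAlloc a ≤ M.alloc x z
      + C * ((X.law a).real {ω | x ≤ X.D ω} + (X.law a).real {ω | ∑ j, X.Z j ω ≤ z}) := by
  have := X.isProbabilityMeasure_law ha
  set s := {ω | x ≤ X.D ω}
  set t := {ω | ∑ j, X.Z j ω ≤ z}
  have hs : MeasurableSet s := measurableSet_le measurable_const X.measurable_D
  have ht : MeasurableSet t := measurableSet_le X.measurable_sum_Z measurable_const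
  have hsi : Integrable (s.indicator fun _ => C) (X.law a) := (integrable_const C).indicator hs
  have hti : Integrable (t.indicator fun _ => C) (X.law a) := (integrable_const C).indicator ht
  have hsti : Integrable (fun ω => s.indicator (fun _ => C) ω + t.indicator (fun _ => C) ω)
    (X.law a) := hsi.add hti
  calc X.expectedAlloc a
      ≤ ∫ ω, (M.alloc x z + (s.indicator (fun _ => C) ω + t.indicator (fun _ => C) ω))
          ∂X.law a := by
        refine integral_mono_ae (X.integrable_alloc hD hΩ ha)
          ((integrable_const _).add hsti) ?_
        -- Off both events, D ≤ x and T ≥ z, so Ω(D, T) ≤ Ω(x, z); on either event the uniform bound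
        -- C takes over.
        filter_upwards [X.ae_D_nonneg hD ha] with ω hω
        have hT := X.sum_Z_nonneg ω
        have hxz := hΩ.nonneg x z hx hz
        have h1 : 0 ≤ s.indicator (fun _ => C) ω := Set.indicator_nonneg (fun _ _ => hC0) ω
        have h2 : 0 ≤ t.indicator (fun _ => C) ω := Set.indicator_nonneg (fun _ _ => hC0) ω
        by_cases hωs : ω ∈ s
        · rw [Set.indicator_of_mem hωs]
          linarith [hC _ _ hω hT]
        by_cases hωt : ω ∈ t
        · rw [Set.indicator_of_mem hωt]
          linarith [hC _ _ hω hT]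
        have hωs' : X.D ω ≤ x := (not_le.1 hωs).le
        have hωt' : z ≤ ∑ j, X.Z j ω := (not_le.1 hωt).le
        have h3 := hΩ.mono_demand _ hT hω hx hωs'
        have h4 := hΩ.anti_supply x hx hz hT hωt'
        simp only at h3 h4
        linarith
    _ = _ := by
        rw [integral_add (integrable_const _) hsti,
          integral_add hsi hti, integral_indicator_const _ hs, integral_indicator_const _ ht]
        simp
        ring

/-- Lower bound on the expected allocation, by monotonicity. -/
lemma sub_le_expectedAlloc (hD : M.DemandAssumption) (hΩ : M.AllocationAssumption)
    (ha : X.Pr (X.A ⁻¹' {a}) ≠ 0) {C : ℝ} (hC0 : 0 ≤ C)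
    (hC : ∀ d t, 0 ≤ d → 0 ≤ t → M.alloc d t ≤ C) {x z : ℝ} (hx : 0 ≤ x) (hz : 0 ≤ z) :
    M.alloc x z - C * ((X.law a).real {ω | X.D ω ≤ x} + (X.law a).real {ω | z ≤ ∑ j, X.Z j ω})
      ≤ X.expectedAlloc a := by
  have := X.isProbabilityMeasure_law ha
  set s := {ω | X.D ω ≤ x}
  set t := {ω | z ≤ ∑ j, X.Z j ω}
  have hs : MeasurableSet s := measurableSet_le X.measurable_D measurable_const
  have ht : MeasurableSet t := measurableSet_le measurable_const X.measurable_sum_Z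
  have hsi : Integrable (s.indicator fun _ => C) (X.law a) := (integrable_const C).indicator hs
  have hti : Integrable (t.indicator fun _ => C) (X.law a) := (integrable_const C).indicator ht
  have hsti : Integrable (fun ω => s.indicator (fun _ => C) ω + t.indicator (fun _ => C) ω)
    (X.law a) := hsi.add hti
  calc _ = ∫ ω, (M.alloc x z - (s.indicator (fun _ => C) ω + t.indicator (fun _ => C) ω))
          ∂X.law a := by
        rw [integral_sub (integrable_const _) hsti,
          integral_add hsi hti, integral_indicator_const _ hs, integral_indicator_const _ ht]
        simp
        ring
    _ ≤ X.expectedAlloc a := by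
        refine integral_mono_ae ((integrable_const _).sub hsti)
          (X.integrable_alloc hD hΩ ha) ?_
        filter_upwards [X.ae_D_nonneg hD ha] with ω hω
        have hT := X.sum_Z_nonneg ω
        have hxz := hC x z hx hz
        have h1 : 0 ≤ s.indicator (fun _ => C) ω := Set.indicator_nonneg (fun _ _ => hC0) ω
        have h2 : 0 ≤ t.indicator (fun _ => C) ω := Set.indicator_nonneg (fun _ _ => hC0) ω
        by_cases hωs : ω ∈ s
        · rw [Set.indicator_of_mem hωs]
          linarith [hΩ.nonneg _ _ hω hT]
        by_cases hωt : ω ∈ t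
        · rw [Set.indicator_of_mem hωt]
          linarith [hΩ.nonneg _ _ hω hT]
        have hωs' : x ≤ X.D ω := (not_le.1 hωs).le
        have hωt' : ∑ j, X.Z j ω ≤ z := (not_le.1 hωt).le
        have h3 := hΩ.mono_demand z hz hx hω hωs'
        have h4 := hΩ.anti_supply _ hω hT hz hωt'
        simp only at h3 h4
        linarith

/-- The probability of being active when payments are `p + z` or `p - z`, equally likely. -/
noncomputable def activeProb (a : 𝒜) (p z : ℝ) : ℝ :=
  (M.choiceMean a ((p + z) * X.expectedAlloc a)
    + M.choiceMean a ((p - z) * X.expectedAlloc a)) / 2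

/-- The anticipated allocation is a number, so given the state the Z_i are independent with common
mean `activeProb`, and Chebyshev applies. -/
lemma sampleMean_Z_deviation_le (hD : M.DemandAssumption) (hΩ : M.AllocationAssumption)
    (hf : M.ChoiceAssumption) (ha : X.Pr (X.A ⁻¹' {a}) ≠ 0) {p z : ℝ}
    (hπ : π = perturbedPayment p z) (hz : 0 ≤ z) (hzp : z ≤ p) (hn : 0 < n) {c : ℝ} (hc : 0 < c) :
    (X.law a).real {ω | c ≤ |sampleMean (fun i => X.Z i ω) - X.activeProb a p z|}
      ≤ 1 / (n * c ^ 2) := by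
  have := X.isProbabilityMeasure_law ha
  refine measureReal_sampleMean_deviation_le hn X.measurable_Z
    ((X.indep_suppliers a ha).comp (fun _ y => y.2.2) fun _ => by fun_prop)
    (fun i => .of_forall fun ω => ⟨by linarith [(X.Z_mem_Icc i ω).1], (X.Z_mem_Icc i ω).2⟩)
    (fun i => ?_) hc
  have := X.integral_Z_mul hD hΩ hf ha hπ hz hzp (g := fun _ => 1) measurable_const i
  simpa [activeProb] using this

/-- The probability of being active is nearly that at the unperturbed payment. -/
lemma abs_activeProb_sub_le (hD : M.DemandAssumption) (hΩ : M.AllocationAssumption)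
    (ha : X.Pr (X.A ⁻¹' {a}) ≠ 0) {p z C L : ℝ} (hz : 0 ≤ z) (hzp : z ≤ p)
    (hC : ∀ d t, 0 ≤ d → 0 ≤ t → M.alloc d t ≤ C) (hL : 0 ≤ L)
    (hLip : ∀ x y, 0 ≤ x → 0 ≤ y → |M.choiceMean a y - M.choiceMean a x| ≤ L * |y - x|) :
    |X.activeProb a p z - M.choiceMean a (p * X.expectedAlloc a)| ≤ L * (z * C) := by
  have hq := X.expectedAlloc_nonneg hD hΩ ha
  have hqC := X.expectedAlloc_le hD hΩ ha hC
  rw [activeProb]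
  set q := X.expectedAlloc a
  have h1 := hLip (p * q) ((p + z) * q) (by nlinarith) (by nlinarith)
  have h2 := hLip (p * q) ((p - z) * q) (by nlinarith) (by nlinarith)
  have e1 : (p + z) * q - p * q = z * q := by ring
  have e2 : (p - z) * q - p * q = -(z * q) := by ring
  rw [e1, abs_of_nonneg (mul_nonneg hz hq), abs_le] at h1
  rw [e2, abs_neg, abs_of_nonneg (mul_nonneg hz hq), abs_le] at h2
  have h3 : L * (z * q) ≤ L * (z * C) := by gcongr
  rw [abs_le]
  constructor <;> linarith [h1.1, h1.2, h2.1, h2.2]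

end

/-- The probability of being active converges to the mean-field supply. -/
lemma eventually_abs_activeProb_sub_lt (hD : M.DemandAssumption) (hΩ : M.AllocationAssumption)
    (hf : M.ChoiceAssumption) {a : 𝒜} {p μ : ℝ} (hp : 0 < p) (hμ : M.IsMeanFieldSupply a p μ)
    {z : ℕ → ℝ} (hz : Tendsto z atTop (𝓝 0)) (hz0 : ∀ᶠ n in atTop, 0 ≤ z n)
    {e : ℝ} (he : 0 < e) :
    ∀ᶠ n : ℕ in atTop, ∀ (π : Measure ℝ) (X : EquilibriumPeriod.{u} M n π),
      π = perturbedPayment p (z n) → X.Pr (X.A ⁻¹' {a}) ≠ 0 →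
      |X.activeProb a p (z n) - μ| < e := by
  have hμ0 : 0 < μ := hμ.1
  -- Keeps the comparison levels μ - e/2 for supply and d - k for demand positive.
  wlog heμ : e < μ generalizing e
  · filter_upwards [this (e := μ / 2) (by positivity) (by linarith)] with n hn π X hπ ha
    exact (hn π X hπ ha).trans (by linarith)
  have hd := hD.mean_pos a
  set d := M.demandMean a with hd_def
  obtain ⟨C, hC0, hC⟩ := hΩ.exists_alloc_bound
  obtain ⟨L, hL, hLip⟩ := hf.exists_choiceMean_lipschitz a
  have hw := hΩ.regular.mem_Icc (d / μ) (div_pos hd hμ0).le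
  have hμeq : μ = M.choiceMean a (p * M.allocLim (d / μ)) := hμ.2.2
  set w := M.allocLim (d / μ)
  -- the demand levels for which the demand per active supplier is still `d / μ`
  set k := d * (e / 2) / μ with hk
  have hk0 : 0 < k := by positivity
  have hkd : k < d := by
    rw [hk, div_lt_iff₀ hμ0]; exact mul_lt_mul_of_pos_left (by linarith) hd
  have hup : Tendsto (fun n : ℕ => M.alloc (n * (d + k)) (n * (μ + e / 2))) atTop (𝓝 w) := by
    have := hΩ.tendsto_alloc (x := d + k) (z := μ + e / 2) (by positivity) (by positivity)
    have h : (d + k) / (μ + e / 2) = d / μ := by rw [hk]; field_simp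
    rwa [h] at this
  have hdown : Tendsto (fun n : ℕ => M.alloc (n * (d - k)) (n * (μ - e / 2))) atTop (𝓝 w) := by
    have := hΩ.tendsto_alloc (x := d - k) (z := μ - e / 2) (by linarith) (by linarith)
    have h : (d - k) / (μ - e / 2) = d / μ := by
      rw [hk, div_eq_div_iff (by linarith) hμ0.ne']; field_simp
    rwa [h] at this
  -- q is compared with w up to 2τ: one τ for the convergence of Ω at the comparison point, one for
  -- C times the exceptional probabilities. This moves F(pq) by at most 2Lpτ = e/2, and the
  -- perturbation of payments by at most e/4, which together is less than e.
  set τ := e / (4 * L * p) with hτ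
  have hτ0 : 0 < τ := by positivity
  have hzs : ∀ᶠ n in atTop, z n < min p (e / (4 * L * C)) :=
    hz.eventually_lt_const (by positivity)
  have hcheb : Tendsto (fun n : ℕ => 1 / ((n : ℝ) * (e / 2) ^ 2)) atTop (𝓝 0) :=
    tendsto_const_nhds.div_atTop (tendsto_natCast_atTop_atTop.atTop_mul_const (by positivity))
  filter_upwards [hup.eventually_lt_const (show w < w + τ by linarith),
    hdown.eventually_const_lt (show w - τ < w by linarith), hz0, hzs,
    hcheb.eventually_lt_const (show 0 < τ / (2 * C) by positivity), eventually_gt_atTop 0,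
    eventually_demand_deviation_le.{u} hD a hk0 (show 0 < τ / (2 * C) by positivity)]
    with n hup hdown hz0 hzs hcheb hn hdem π X hπ ha
  have hprob := X.isProbabilityMeasure_law ha
  have hn' : (0 : ℝ) < n := Nat.cast_pos.2 hn
  have hzp : z n ≤ p := (hzs.trans_le (min_le_left _ _)).le
  have hzC : L * (z n * C) ≤ e / 4 := by
    have := (hzs.trans_le (min_le_right _ _)).le
    rw [le_div_iff₀ (by positivity)] at this
    linarith
  have hact := abs_le.1 (X.abs_activeProb_sub_le hD hΩ ha hz0 hzp hC hL.le hLip)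
  have hq := X.expectedAlloc_nonneg hD hΩ ha
  have hdem' := hdem π X ha
  have hsup := X.sampleMean_Z_deviation_le hD hΩ hf ha hπ hz0 hzp hn (half_pos he)
  set m := X.activeProb a p (z n)
  set q := X.expectedAlloc a
  have hLp : L * (p * (2 * τ)) = e / 2 := by rw [hτ]; field_simp; ring
  have hCτ : C * (τ / (2 * C) + τ / (2 * C)) = τ := by field_simp; ring
  rw [abs_lt]
  constructor
  -- If m ≤ μ - e, supply is below n(μ - e/2) with high probability and demand above n(d - k), a
  -- pair with ratio d/μ. So q ≥ w - 2τ, hence F(pq) ≥ μ - e/2, which is incompatible with m.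
  · by_contra! hcon
    have h1 : (X.law a).real {ω | X.D ω ≤ n * (d - k)} ≤ τ / (2 * C) := by
      refine (measureReal_mono fun ω hω => ?_).trans hdem'
      have : X.D ω / n ≤ d - k := by rw [div_le_iff₀ hn', mul_comm]; exact hω
      change k ≤ |X.D ω / n - d|
      exact le_abs.2 (Or.inr (by linarith))
    have h2 : (X.law a).real {ω | n * (μ - e / 2) ≤ ∑ j, X.Z j ω} ≤ τ / (2 * C) := by
      refine (measureReal_mono fun ω hω => ?_).trans (hsup.trans hcheb.le)
      have : μ - e / 2 ≤ sampleMean fun i => X.Z i ω := by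
        rw [sampleMean, le_div_iff₀ hn', mul_comm]; exact hω
      change e / 2 ≤ |_ - m|
      exact le_abs.2 (Or.inl (by linarith))
    have h3 := X.sub_le_expectedAlloc hD hΩ ha hC0.le hC (x := n * (d - k))
      (z := n * (μ - e / 2)) (mul_nonneg hn'.le (by linarith)) (mul_nonneg hn'.le (by linarith))
    have h4 := mul_le_mul_of_nonneg_left (add_le_add h1 h2) hC0.le
    have hqw : w - 2 * τ ≤ q := by linarith
    rcases le_total w q with hwq | hwq
    · have := hf.choiceMean_mono a (mul_nonneg hp.le hw.1) (mul_le_mul_of_nonneg_left hwq hp.le)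
      linarith
    · have h5 := hLip (p * q) (p * w) (mul_nonneg hp.le hq) (mul_nonneg hp.le hw.1)
      rw [← mul_sub, abs_mul, abs_of_pos hp, abs_of_nonneg (by linarith : 0 ≤ w - q)] at h5
      have h6 : L * (p * (w - q)) ≤ L * (p * (2 * τ)) := by gcongr; linarith
      linarith [le_abs_self (M.choiceMean a (p * w) - M.choiceMean a (p * q))]
  -- Mirror image: excessive supply forces q ≤ w + 2τ.
  · by_contra! hcon
    have h1 : (X.law a).real {ω | n * (d + k) ≤ X.D ω} ≤ τ / (2 * C) := by
      refine (measureReal_mono fun ω hω => ?_).trans hdem'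
      have : d + k ≤ X.D ω / n := by rw [le_div_iff₀ hn', mul_comm]; exact hω
      change k ≤ |X.D ω / n - d|
      exact le_abs.2 (Or.inl (by linarith))
    have h2 : (X.law a).real {ω | ∑ j, X.Z j ω ≤ n * (μ + e / 2)} ≤ τ / (2 * C) := by
      refine (measureReal_mono fun ω hω => ?_).trans (hsup.trans hcheb.le)
      have : (sampleMean fun i => X.Z i ω) ≤ μ + e / 2 := by
        rw [sampleMean, div_le_iff₀ hn', mul_comm]; exact hω
      change e / 2 ≤ |_ - m|
      exact le_abs.2 (Or.inr (by linarith))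
    have h3 := X.expectedAlloc_le_add hD hΩ ha hC0.le hC (x := n * (d + k))
      (z := n * (μ + e / 2)) (by positivity) (by positivity)
    have h4 := mul_le_mul_of_nonneg_left (add_le_add h1 h2) hC0.le
    have hqw : q ≤ w + 2 * τ := by linarith
    rcases le_total q w with hwq | hwq
    · have := hf.choiceMean_mono a (mul_nonneg hp.le hq) (mul_le_mul_of_nonneg_left hwq hp.le)
      linarith
    · have h5 := hLip (p * w) (p * q) (mul_nonneg hp.le hw.1) (mul_nonneg hp.le hq)
      rw [← mul_sub, abs_mul, abs_of_pos hp, abs_of_nonneg (by linarith : 0 ≤ q - w)] at h5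
      have h6 : L * (p * (q - w)) ≤ L * (p * (2 * τ)) := by gcongr; linarith
      linarith [le_abs_self (M.choiceMean a (p * q) - M.choiceMean a (p * w))]

/-- Relative supply converges in probability, uniformly over all periods. -/
lemma eventually_supply_deviation_le (hD : M.DemandAssumption) (hΩ : M.AllocationAssumption)
    (hf : M.ChoiceAssumption) {a : 𝒜} {p μ : ℝ} (hp : 0 < p) (hμ : M.IsMeanFieldSupply a p μ)
    {z : ℕ → ℝ} (hz : Tendsto z atTop (𝓝 0)) (hz0 : ∀ᶠ n in atTop, 0 ≤ z n)
    {ρ θ : ℝ} (hρ : 0 < ρ) (hθ : 0 < θ) :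
    ∀ᶠ n : ℕ in atTop, ∀ (π : Measure ℝ) (X : EquilibriumPeriod.{u} M n π),
      π = perturbedPayment p (z n) → X.Pr (X.A ⁻¹' {a}) ≠ 0 →
      (X.law a).real {ω | ρ ≤ |sampleMean (fun i => X.Z i ω) - μ|} ≤ θ := by
  have hcheb : Tendsto (fun n : ℕ => 1 / ((n : ℝ) * (ρ / 2) ^ 2)) atTop (𝓝 0) :=
    tendsto_const_nhds.div_atTop (tendsto_natCast_atTop_atTop.atTop_mul_const (by positivity))
  filter_upwards [eventually_abs_activeProb_sub_lt.{u} hD hΩ hf hp hμ hz hz0 (half_pos hρ),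
    hcheb.eventually_lt_const hθ, eventually_gt_atTop 0, hz0, hz.eventually_lt_const hp]
    with n hact hcheb hn hz0 hzp π X hπ ha
  have hprob := X.isProbabilityMeasure_law ha
  refine (measureReal_mono fun ω hω => ?_).trans
    ((X.sampleMean_Z_deviation_le hD hΩ hf ha hπ hz0 hzp.le hn (half_pos hρ)).trans hcheb.le)
  have h1 := hact π X hπ ha
  have h2 : ρ ≤ |sampleMean (fun i => X.Z i ω) - μ| := hω
  have h3 := abs_sub_le (sampleMean fun i => X.Z i ω) (X.activeProb a p (z n)) μ
  change ρ / 2 ≤ |_|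
  linarith

/-- Expectations of functions of demand and supply converge if the functions grow at most linearly
in relative demand and are close to the limit when relative demand and supply are. -/
lemma eventually_abs_integral_sub_le (hD : M.DemandAssumption) (hΩ : M.AllocationAssumption)
    (hf : M.ChoiceAssumption) {a : 𝒜} {p μ : ℝ} (hp : 0 < p) (hμ : M.IsMeanFieldSupply a p μ)
    {z : ℕ → ℝ} (hz : Tendsto z atTop (𝓝 0)) (hz0 : ∀ᶠ n in atTop, 0 ≤ z n)
    {g : ℕ → ℝ → ℝ → ℝ} {y C : ℝ} (hC : 0 ≤ C)
    (hbound : ∀ (n : ℕ) (d t : ℝ), 0 < n → 0 ≤ d → 0 ≤ t → t ≤ n → |g n d t - y| ≤ C * (1 + d / n))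
    (hclose : ∀ η > 0, ∃ ρ > 0, ∀ᶠ n : ℕ in atTop, ∀ d t : ℝ, |d / n - M.demandMean a| < ρ →
      |t / n - μ| < ρ → |g n d t - y| ≤ η)
    {η : ℝ} (hη : 0 < η) :
    ∀ᶠ n : ℕ in atTop, ∀ (π : Measure ℝ) (X : EquilibriumPeriod.{u} M n π),
      π = perturbedPayment p (z n) → X.Pr (X.A ⁻¹' {a}) ≠ 0 →
      AEStronglyMeasurable (fun ω => g n (X.D ω) (∑ j, X.Z j ω)) (X.law a) →
      |∫ ω, g n (X.D ω) (∑ j, X.Z j ω) ∂X.law a - y| ≤ η := by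
  have hd := hD.mean_pos a
  set d := M.demandMean a with hd_def
  obtain ⟨ρ, hρ, hclose⟩ := hclose (η / 4) (by positivity)
  -- With x = D/n - d, 1 + x + d ≤ (2 + d)(1 + x²), so linear growth is dominated by κ + κx². The
  -- extra 1 keeps κ positive when C = 0.
  set κ := C * (2 + d) + 1 with hκ
  have hκ0 : 0 < κ := by positivity
  filter_upwards [hclose, eventually_gt_atTop 0,
    eventually_integral_sq_demand_le.{u} hD a (θ := η / (4 * κ)) (by positivity),
    eventually_demand_deviation_le.{u} hD a hρ (θ := η / (4 * κ)) (by positivity),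
    eventually_supply_deviation_le.{u} hD hΩ hf hp hμ hz hz0 hρ (θ := η / (4 * κ))
      (by positivity)] with n hclose hn hsq hdem hsup π X hπ ha hmeas
  have hprob := X.isProbabilityMeasure_law ha
  obtain ⟨hsqi, hsq⟩ := hsq π X ha
  have hdem := hdem π X ha
  have hsup := hsup π X hπ ha
  have hn' : (0 : ℝ) < n := Nat.cast_pos.2 hn
  set s := {ω | ρ ≤ |X.D ω / n - d|} with hs_def
  set t := {ω | ρ ≤ |sampleMean (fun i => X.Z i ω) - μ|} with ht_def
  have hs : MeasurableSet s :=
    measurableSet_le measurable_const (((X.measurable_D.div_const _).sub_const _).abs)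
  have ht : MeasurableSet t := measurableSet_le measurable_const
    (((X.measurable_sum_Z.div_const _).sub_const _).abs)
  have hsi : Integrable (s.indicator fun _ => κ) (X.law a) := (integrable_const κ).indicator hs
  have hti : Integrable (t.indicator fun _ => κ) (X.law a) := (integrable_const κ).indicator ht
  -- Each of the four terms has mean at most η/4: closeness on the good event, the two bad events,
  -- and the mean-square tail of demand.
  set B : X.Sample → ℝ := fun ω => η / 4 + (s.indicator (fun _ => κ) ω
    + (t.indicator (fun _ => κ) ω + κ * (X.D ω / n - d) ^ 2)) with hB
  have hBi : Integrable B (X.law a) :=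
    (integrable_const _).add (hsi.add (hti.add (hsqi.const_mul κ)))
  have hle : ∀ᵐ ω ∂X.law a, ‖g n (X.D ω) (∑ j, X.Z j ω) - y‖ ≤ B ω := by
    filter_upwards [X.ae_D_nonneg hD ha] with ω hω
    have h0 : 0 ≤ κ * (X.D ω / n - d) ^ 2 := by positivity
    have h1 : 0 ≤ s.indicator (fun _ => κ) ω := Set.indicator_nonneg (fun _ _ => hκ0.le) ω
    have h2 : 0 ≤ t.indicator (fun _ => κ) ω := Set.indicator_nonneg (fun _ _ => hκ0.le) ω
    have h3 : |g n (X.D ω) (∑ j, X.Z j ω) - y| ≤ κ + κ * (X.D ω / n - d) ^ 2 := by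
      refine (hbound n _ _ hn hω (X.sum_Z_nonneg ω) (X.sum_Z_le ω)).trans ?_
      set x := X.D ω / n - d
      have e : X.D ω / n = x + d := by ring
      rw [e]
      have h4 : 1 + (x + d) ≤ (2 + d) + (2 + d) * x ^ 2 := by nlinarith [sq_nonneg (x - 1)]
      have h5 := mul_le_mul_of_nonneg_left h4 hC
      have h6 : C * ((2 + d) + (2 + d) * x ^ 2) = (κ - 1) + (κ - 1) * x ^ 2 := by rw [hκ]; ring
      nlinarith [sq_nonneg x]
    rw [Real.norm_eq_abs]
    simp only [hB]
    by_cases hωs : ω ∈ s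
    · rw [Set.indicator_of_mem hωs]; linarith
    by_cases hωt : ω ∈ t
    · rw [Set.indicator_of_mem hωt]; linarith
    have := hclose (X.D ω) (∑ j, X.Z j ω) (not_le.1 hωs) (not_le.1 hωt)
    linarith
  have hgi : Integrable (fun ω => g n (X.D ω) (∑ j, X.Z j ω)) (X.law a) := by
    have h1 : Integrable (fun ω => g n (X.D ω) (∑ j, X.Z j ω) - y) (X.law a) :=
      hBi.mono' (hmeas.sub aestronglyMeasurable_const) hle
    exact (h1.add (integrable_const y)).congr (.of_forall fun ω => by simp)
  have h1 : ∫ ω, g n (X.D ω) (∑ j, X.Z j ω) ∂X.law a - y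
      = ∫ ω, (g n (X.D ω) (∑ j, X.Z j ω) - y) ∂X.law a := by
    rw [integral_sub hgi (integrable_const _)]; simp
  have h2 : ∫ ω, B ω ∂X.law a = η / 4 + ((X.law a).real s * κ + ((X.law a).real t * κ
      + κ * ∫ ω, (X.D ω / n - d) ^ 2 ∂X.law a)) := by
    have hi2 : Integrable (fun ω => t.indicator (fun _ => κ) ω + κ * (X.D ω / n - d) ^ 2)
      (X.law a) := hti.add (hsqi.const_mul κ)
    have hi1 : Integrable (fun ω => s.indicator (fun _ => κ) ω
      + (t.indicator (fun _ => κ) ω + κ * (X.D ω / n - d) ^ 2)) (X.law a) := hsi.add hi2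
    rw [hB, integral_add (integrable_const _) hi1, integral_add hsi hi2,
      integral_add hti (hsqi.const_mul κ), integral_indicator_const _ hs,
      integral_indicator_const _ ht, integral_const_mul, hd_def]
    simp
  rw [h1]
  refine (norm_integral_le_of_norm_le hBi hle).trans ?_
  rw [h2]
  have h3 := mul_le_mul_of_nonneg_right hdem hκ0.le
  have h4 := mul_le_mul_of_nonneg_right hsup hκ0.le
  have h5 := mul_le_mul_of_nonneg_left hsq hκ0.le
  have h6 : η / (4 * κ) * κ = η / 4 := by field_simp
  linarith

end EquilibriumPeriod

/-! ### Limits of expected allocations and utilities -/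

/-- Here d ≥ n x₀/2 and t ≥ n z₀/2, so both arguments pass any threshold as n grows. -/
lemma IsErrorFunction.eventually_abs_le_near {l : ℝ → ℝ → ℝ} (h : IsErrorFunction l)
    {x₀ z₀ η : ℝ} (hx : 0 < x₀) (hz : 0 < z₀) (hη : 0 < η) :
    ∀ᶠ n : ℕ in atTop, ∀ d t : ℝ, |d / n - x₀| < x₀ / 2 → |t / n - z₀| < z₀ / 2 →
      |l d t| ≤ η := by
  obtain ⟨N, hN⟩ := h.exists_abs_le hη
  have hxt : Tendsto (fun n : ℕ => (n : ℝ) * (x₀ / 2)) atTop atTop :=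
    tendsto_natCast_atTop_atTop.atTop_mul_const (by positivity)
  have hzt : Tendsto (fun n : ℕ => (n : ℝ) * (z₀ / 2)) atTop atTop :=
    tendsto_natCast_atTop_atTop.atTop_mul_const (by positivity)
  filter_upwards [hxt.eventually_ge_atTop N, hzt.eventually_ge_atTop N, eventually_gt_atTop 0]
    with n h1 h2 hn d t hd ht
  have hn' : (0 : ℝ) < n := Nat.cast_pos.2 hn
  have hd' : x₀ / 2 ≤ d / n := by linarith [(abs_lt.1 hd).1]
  have ht' : z₀ / 2 ≤ t / n := by linarith [(abs_lt.1 ht).1]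
  rw [le_div_iff₀ hn', mul_comm] at hd' ht'
  exact hN d t (h1.trans hd') (h2.trans ht')

/-- The `ε`-`δ` form of continuity of a function of two real variables. -/
lemma ContinuousAt.exists_forall_abs_sub_lt {H : ℝ × ℝ → ℝ} {x₀ z₀ η : ℝ}
    (h : ContinuousAt H (x₀, z₀)) (hη : 0 < η) :
    ∃ ρ > 0, ∀ x z, |x - x₀| < ρ → |z - z₀| < ρ → |H (x, z) - H (x₀, z₀)| < η := by
  obtain ⟨ρ, hρ, hH⟩ := Metric.continuousAt_iff.1 h η hη
  refine ⟨ρ, hρ, fun x z hx hz => hH ?_⟩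
  rw [Prod.dist_eq, max_lt_iff]
  exact ⟨hx, hz⟩

lemma continuousAt_comp_div {φ : ℝ → ℝ} {x₀ z₀ : ℝ} (hz : 0 < z₀)
    (hφ : ContinuousAt φ (x₀ / z₀)) :
    ContinuousAt (fun y : ℝ × ℝ => φ (y.1 / y.2)) (x₀, z₀) :=
  ContinuousAt.comp (f := fun y : ℝ × ℝ => y.1 / y.2) hφ
    (continuousAt_fst.div continuousAt_snd hz.ne')

namespace EquilibriumPeriod

variable {𝒜 : Type v} {ℬ : Type w} [MeasurableSpace 𝒜] [MeasurableSpace ℬ]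
  {M : Market 𝒜 ℬ}

/-- The expected allocation to an active supplier converges to its mean-field value. -/
lemma eventually_abs_expectedAlloc_sub_le (hD : M.DemandAssumption)
    (hΩ : M.AllocationAssumption) (hf : M.ChoiceAssumption) {a : 𝒜} {p μ : ℝ} (hp : 0 < p)
    (hμ : M.IsMeanFieldSupply a p μ) {z : ℕ → ℝ} (hz : Tendsto z atTop (𝓝 0))
    (hz0 : ∀ᶠ n in atTop, 0 ≤ z n) {η : ℝ} (hη : 0 < η) :
    ∀ᶠ n : ℕ in atTop, ∀ (π : Measure ℝ) (X : EquilibriumPeriod.{u} M n π),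
      π = perturbedPayment p (z n) → X.Pr (X.A ⁻¹' {a}) ≠ 0 →
      |X.expectedAlloc a - M.allocLim (M.demandMean a / μ)| ≤ η := by
  have hd := hD.mean_pos a
  have hμ0 : 0 < μ := hμ.1
  have hx := div_pos hd hμ0
  have hw := hΩ.regular.mem_Icc _ hx.le
  obtain ⟨C, hC0, hC⟩ := hΩ.exists_alloc_bound
  obtain ⟨l, hl, happ⟩ := hΩ.approx
  have key := eventually_abs_integral_sub_le.{u} hD hΩ hf hp hμ hz hz0
    (g := fun _ => M.alloc) (y := M.allocLim (M.demandMean a / μ)) (C := C + 1) (by positivity)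
    (fun n d t hn hd' ht htn => by
      have h1 := hC d t hd' ht
      have h2 := hΩ.nonneg d t hd' ht
      have h3 : 0 ≤ (C + 1) * (d / n) := by positivity
      rw [abs_le]
      constructor <;> linarith [hw.1, hw.2])
    (fun η hη => by
      obtain ⟨ρ, hρ, hcont⟩ := (continuousAt_comp_div hμ0
        (hΩ.regular.hasDerivAt hx).continuousAt).exists_forall_abs_sub_lt (half_pos hη)
      -- Beyond continuity of ω(d/t), the radius keeps demand and supply of order n, so that Ω = ω +
      -- l applies with a small error.
      refine ⟨min ρ (min (M.demandMean a / 2) (μ / 2)), by positivity, ?_⟩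
      filter_upwards [hl.eventually_abs_le_near hd hμ0 (half_pos hη), eventually_gt_atTop 0]
        with n hln hn d t hd' ht'
      have hn' : (0 : ℝ) < n := Nat.cast_pos.2 hn
      rw [lt_min_iff, lt_min_iff] at hd' ht'
      have hdpos : 0 < d := by
        have : 0 < d / n := by linarith [(abs_lt.1 hd'.2.1).1]
        exact (div_pos_iff_of_pos_right hn').1 this
      have htpos : 0 < t := by
        have : 0 < t / n := by linarith [(abs_lt.1 ht'.2.2).1]
        exact (div_pos_iff_of_pos_right hn').1 this
      have h1 := hcont _ _ hd'.1 ht'.1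
      simp only [div_div_div_cancel_right₀ hn'.ne'] at h1
      have h2 := hln d t hd'.2.1 ht'.2.2
      rw [happ d t hdpos.le htpos]
      rw [abs_lt] at h1
      rw [abs_le] at *
      constructor <;> linarith [h1.1, h1.2, h2.1, h2.2])
    hη
  filter_upwards [key] with n hn π X hπ ha
  exact hn π X hπ ha (X.aestronglyMeasurable_alloc hD hΩ ha)

/-- The expected utilities converge to the mean-field utility. -/
lemma tendsto_utility [MeasurableSingletonClass 𝒜] (hD : M.DemandAssumption)
    (hΩ : M.AllocationAssumption) (hf : M.ChoiceAssumption) (hR : M.RevenueAssumption)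
    {a : 𝒜} {p : ℝ} (hp : 0 < p) (hv : M.Viable a p)
    (Y : ∀ n : ℕ, EquilibriumPeriod.{u} M n (Measure.dirac p))
    (hY : ∀ n, (Y n).Pr ((Y n).A ⁻¹' {a}) ≠ 0) :
    Tendsto (fun n => (Y n).utility a) atTop (𝓝 (M.meanFieldUtility a p)) := by
  have hμ := hv.isMeanFieldSupply hD hΩ hf hp
  have hd := hD.mean_pos a
  rw [Market.meanFieldUtility]
  set μ := M.meanFieldSupply a p
  have hμ0 : 0 < μ := hμ.1
  have hx := div_pos hd hμ0
  set y := (M.revenueLim (M.demandMean a / μ) - p * M.allocLim (M.demandMean a / μ)) * μ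
    with hy
  obtain ⟨C, hC0, hC⟩ := hΩ.exists_alloc_bound
  obtain ⟨CR, hCR0, hCR⟩ := hR.exists_bound
  obtain ⟨l, hl, happ⟩ := hΩ.approx
  obtain ⟨l', hl', happ'⟩ := hR.approx
  have hint : ∀ n, Integrable
      (fun ω => M.revenue ((Y n).D ω) (∑ j, (Y n).Z j ω)) ((Y n).law a) := by
    intro n
    have hprob := (Y n).isProbabilityMeasure_law (hY n)
    have hDi : Integrable (Y n).D ((Y n).law a) := by
      have := hD.integrable n a
      rw [← (Y n).law_D a (hY n)] at this
      exact this.comp_measurable (Y n).measurable_D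
    refine Integrable.mono' ((hDi.add (integrable_const (n : ℝ))).const_mul CR)
      ((Y n).measurable_demand_supply hR.measurable).aestronglyMeasurable ?_
    filter_upwards [(Y n).ae_D_nonneg hD (hY n)] with ω hω
    refine (hCR _ _ hω ((Y n).sum_Z_nonneg ω)).trans ?_
    exact mul_le_mul_of_nonneg_left (add_le_add le_rfl ((Y n).sum_Z_le ω)) hCR0
  have key := fun η (hη : 0 < η) => eventually_abs_integral_sub_le.{u} hD hΩ hf hp hμ
    (z := fun _ => 0) tendsto_const_nhds (.of_forall fun _ => le_rfl)
    (g := fun n d t => (M.revenue d t - p * t * M.alloc d t) / n) (y := y)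
    (C := CR + p * C + |y|) (by positivity)
    (fun n d t hn hd' ht htn => by
      have hn' : (0 : ℝ) < n := Nat.cast_pos.2 hn
      have h1 := hCR d t hd' ht
      have h2 : |p * t * M.alloc d t| ≤ p * n * C := by
        rw [abs_of_nonneg (mul_nonneg (by positivity) (hΩ.nonneg d t hd' ht))]
        have := hC d t hd' ht
        have := hΩ.nonneg d t hd' ht
        gcongr
      have h3 : |M.revenue d t - p * t * M.alloc d t| ≤ CR * (d + n) + p * n * C := by
        refine (abs_sub _ _).trans (add_le_add (h1.trans ?_) h2)
        gcongr
      have h4 : |(M.revenue d t - p * t * M.alloc d t) / n| ≤ CR * (d / n) + (CR + p * C) := by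
        rw [abs_div, abs_of_pos hn', div_le_iff₀ hn']
        refine h3.trans_eq ?_
        field_simp
        ring
      refine (abs_sub _ _).trans ?_
      have h5 : 0 ≤ (p * C + |y|) * (d / n) := by positivity
      nlinarith)
    (fun η hη => by
      -- The error terms of R and Ω together contribute at most (τ + pτ) · 2μ = η/2, as t/n ≤ 2μ.
      set τ := η / (4 * (1 + p) * μ) with hτ
      have hτ0 : 0 < τ := by positivity
      have hcont : ContinuousAt (fun y : ℝ × ℝ =>
          (M.revenueLim (y.1 / y.2) - p * M.allocLim (y.1 / y.2)) * y.2)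
          (M.demandMean a, μ) :=
        ((continuousAt_comp_div hμ0 (hR.smooth.hasDerivAt_of_pos hx).continuousAt).sub
          (continuousAt_const.mul (continuousAt_comp_div hμ0
            (hΩ.regular.hasDerivAt hx).continuousAt))).mul continuousAt_snd
      obtain ⟨ρ, hρ, hcont⟩ := hcont.exists_forall_abs_sub_lt (half_pos hη)
      refine ⟨min ρ (min (M.demandMean a / 2) (μ / 2)), by positivity, ?_⟩
      filter_upwards [hl.eventually_abs_le_near hd hμ0 hτ0,
        hl'.eventually_abs_le_near hd hμ0 hτ0, eventually_gt_atTop 0]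
        with n hln hln' hn d t hd' ht'
      have hn' : (0 : ℝ) < n := Nat.cast_pos.2 hn
      rw [lt_min_iff, lt_min_iff] at hd' ht'
      have hdpos : 0 < d := by
        have : 0 < d / n := by linarith [(abs_lt.1 hd'.2.1).1]
        exact (div_pos_iff_of_pos_right hn').1 this
      have htpos : 0 < t := by
        have : 0 < t / n := by linarith [(abs_lt.1 ht'.2.2).1]
        exact (div_pos_iff_of_pos_right hn').1 this
      have ht2 : t / n ≤ 2 * μ := by linarith [(abs_lt.1 ht'.2.2).2]
      have h1 := hcont _ _ hd'.1 ht'.1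
      simp only [div_div_div_cancel_right₀ hn'.ne'] at h1
      have h2 := hln d t hd'.2.1 ht'.2.2
      have h3 := hln' d t hd'.2.1 ht'.2.2
      rw [happ d t hdpos.le htpos, happ' d t hdpos.le htpos]
      have h4 : |(l' d t + p * l d t) * (t / n)| ≤ η / 2 := by
        rw [abs_mul, abs_of_pos (by positivity : 0 < t / (n : ℝ))]
        have : |l' d t + p * l d t| ≤ τ + p * τ := by
          refine (abs_add_le _ _).trans (add_le_add h3 ?_)
          rw [abs_mul, abs_of_pos hp]
          gcongr
        calc |l' d t + p * l d t| * (t / n) ≤ (τ + p * τ) * (2 * μ) := by gcongr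
          _ = η / 2 := by rw [hτ]; field_simp; ring
      have e : ((M.revenueLim (d / t) - l' d t) * t - p * t * (M.allocLim (d / t) + l d t)) / n
          - y = ((M.revenueLim (d / t) - p * M.allocLim (d / t)) * (t / n) - y)
            - (l' d t + p * l d t) * (t / n) := by ring
      rw [e]
      refine (abs_sub _ _).trans ?_
      linarith)
    hη
  rw [Metric.tendsto_nhds]
  intro η hη
  filter_upwards [key (η / 2) (half_pos hη)] with n hn
  have hmeas : AEStronglyMeasurable (fun ω => (M.revenue ((Y n).D ω) (∑ j, (Y n).Z j ω)
      - p * (∑ j, (Y n).Z j ω) * M.alloc ((Y n).D ω) (∑ j, (Y n).Z j ω)) / n) ((Y n).law a) := by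
    have h1 := (hint n).aestronglyMeasurable
    have h2 := (Y n).aestronglyMeasurable_alloc hD hΩ (hY n)
    have h3 : AEStronglyMeasurable (fun ω => p * (∑ j, (Y n).Z j ω)) ((Y n).law a) :=
      ((Y n).measurable_sum_Z.const_mul p).aestronglyMeasurable
    exact ((h1.sub (h3.mul h2)).mul_const (n : ℝ)⁻¹).congr (.of_forall fun ω => by
      simp [div_eq_mul_inv])
  have := hn _ (Y n) (perturbedPayment_zero p).symm (hY n) hmeas
  rw [Real.dist_eq, (Y n).utility_eq hD hΩ hf (hY n) rfl (hint n)]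
  linarith

end EquilibriumPeriod

/-! ### The estimator -/

/-- The regression coefficient on centred signs, in terms of sample means. -/
lemma deltaHat_eq {n : ℕ} (hn : 0 < n) (ζ : ℝ) (Z ε : Fin n → ℝ) (hε : ∀ i, ε i ^ 2 = 1) :
    deltaHat ζ Z ε = ζ⁻¹ * (sampleMean (fun i => Z i * ε i) - sampleMean Z * sampleMean ε)
      / (1 - sampleMean ε ^ 2) := by
  have hn' : (n : ℝ) ≠ 0 := Nat.cast_ne_zero.2 hn.ne'
  have hZ : ∑ i, Z i = n * sampleMean Z := by rw [sampleMean]; field_simp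
  have hE : ∑ i, ε i = n * sampleMean ε := by rw [sampleMean]; field_simp
  have hZE : ∑ i, Z i * ε i = n * sampleMean (fun i => Z i * ε i) := by rw [sampleMean]; field_simp
  have h1 : ∑ i, (Z i - sampleMean Z) * (ε i - sampleMean ε)
      = n * (sampleMean (fun i => Z i * ε i) - sampleMean Z * sampleMean ε) := by
    have : ∀ i, (Z i - sampleMean Z) * (ε i - sampleMean ε)
        = Z i * ε i - sampleMean ε * Z i - sampleMean Z * ε i + sampleMean Z * sampleMean ε :=
      fun i => by ring
    simp_rw [this]
    rw [Finset.sum_add_distrib, Finset.sum_sub_distrib, Finset.sum_sub_distrib, ← Finset.mul_sum,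
      ← Finset.mul_sum, hZ, hE, hZE]
    simp
    ring
  have h2 : ∑ i, (ε i - sampleMean ε) ^ 2 = n * (1 - sampleMean ε ^ 2) := by
    have : ∀ i, (ε i - sampleMean ε) ^ 2
        = 1 - 2 * sampleMean ε * ε i + sampleMean ε ^ 2 := fun i => by rw [← hε i]; ring
    simp_rw [this]
    rw [Finset.sum_add_distrib, Finset.sum_sub_distrib, ← Finset.mul_sum, hE]
    simp
    ring
  rw [deltaHat, h1, h2, mul_left_comm, mul_div_mul_left _ _ hn']

/-- The estimator depends continuously on the statistics at the mean-field values. -/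
lemma continuousAt_gammaHat {ω r : ℝ → ℝ} (hω : IsRegularAllocation ω)
    (hr : ContDiffOn ℝ (⊤ : ℕ∞) r (Set.Ioi 0)) {p d μ Δ : ℝ} (hp : 0 < p) (hd : 0 < d)
    (hμ : 0 < μ) (hΔ : 0 ≤ Δ) :
    ContinuousAt (fun y : (ℝ × ℝ) × ℝ => gammaHat ω r p y.1.1 y.1.2 y.2) ((d, μ), Δ) := by
  have hx : 0 < d / μ := div_pos hd hμ
  have comp : ∀ {φ : ℝ → ℝ}, ContinuousAt φ (d / μ) →
      ContinuousAt (fun y : (ℝ × ℝ) × ℝ => φ (y.1.1 / y.1.2)) ((d, μ), Δ) := fun hφ =>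
    ContinuousAt.comp (f := fun y : (ℝ × ℝ) × ℝ => y.1) (continuousAt_comp_div hμ hφ)
      continuousAt_fst
  have hωc := comp (hω.hasDerivAt hx).continuousAt
  have hω'c := comp (hω.smooth.continuousAt_deriv_of_pos hx)
  have hrc := comp (hr.hasDerivAt_of_pos hx).continuousAt
  have hr'c := comp (hr.continuousAt_deriv_of_pos hx)
  have hdiv := comp continuousAt_id
  have hDc : ContinuousAt (fun y : (ℝ × ℝ) × ℝ => y.1.1) ((d, μ), Δ) := by fun_prop
  have hZc : ContinuousAt (fun y : (ℝ × ℝ) × ℝ => y.1.2) ((d, μ), Δ) := by fun_prop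
  have hΔc : ContinuousAt (fun y : (ℝ × ℝ) × ℝ => y.2) ((d, μ), Δ) := by fun_prop
  have hup : ContinuousAt (fun y : (ℝ × ℝ) × ℝ => upsilonHat ω p y.1.1 y.1.2 y.2)
      ((d, μ), Δ) := by
    -- If ω vanishes, the inner quotient has denominator 0 and is read as 0, so Υ̂ is just Δ̂ near
    -- the point.
    rcases hω.eq_zero_or_pos with h0 | hpos
    · refine hΔc.congr ?_
      filter_upwards [hdiv.eventually (lt_mem_nhds hx)] with y hy
      rw [upsilonHat, h0 (y.1.1 / y.1.2) (le_of_lt hy)]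
      simp
    · have hw := hpos _ hx
      have hw' := hω.deriv_nonneg hx
      refine hΔc.div (continuousAt_const.add
        ((((continuousAt_const.mul hDc).mul hΔc).mul hω'c).div ((hZc.pow 2).mul hωc) ?_)) ?_
      · simp only; positivity
      · simp only
        -- Because Δ ≥ 0 and ω is non-decreasing, the outer denominator is at least 1 at the limit
        -- point.
        have : 0 ≤ p * d * Δ * deriv ω (d / μ) / (μ ^ 2 * ω (d / μ)) := by positivity
        linarith
  exact (hup.mul ((hrc.sub (continuousAt_const.mul hωc)).sub
    ((hr'c.sub (continuousAt_const.mul hω'c)).mul hdiv))).sub (hωc.mul hZc)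

namespace EquilibriumPeriod

variable {𝒜 : Type v} {ℬ : Type w} [MeasurableSpace 𝒜] [MeasurableSpace ℬ]
  {M : Market 𝒜 ℬ}

section

variable {n : ℕ} {π : Measure ℝ} (X : EquilibriumPeriod.{u} M n π) {a : 𝒜}

/-- The sign `ε_i` of the perturbation of the payment `p + z ε_i`. -/
noncomputable def sign (p z : ℝ) (i : Fin n) (ω : X.Sample) : ℝ := (X.P i ω - p) / z

lemma measurable_sign (p z : ℝ) (i : Fin n) : Measurable (X.sign p z i) :=
  ((X.measurable_P i).sub_const p).div_const z

lemma ae_sign_eq (hf : M.ChoiceAssumption) (ha : X.Pr (X.A ⁻¹' {a}) ≠ 0) {p z : ℝ}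
    (hπ : π = perturbedPayment p z) (hz : 0 < z) (i : Fin n) :
    ∀ᵐ ω ∂X.law a, X.sign p z i ω = 1 ∨ X.sign p z i ω = -1 := by
  filter_upwards [X.ae_P_eq hf ha hπ i] with ω hω
  rcases hω with h | h
  · left
    rw [sign, h, add_sub_cancel_left, div_self hz.ne']
  · right
    rw [sign, h, sub_sub_cancel_left, neg_div, div_self hz.ne']

lemma sampleMean_sign_deviation_le (hf : M.ChoiceAssumption) (ha : X.Pr (X.A ⁻¹' {a}) ≠ 0)
    {p z : ℝ} (hπ : π = perturbedPayment p z) (hz : 0 < z) (hn : 0 < n) {c : ℝ} (hc : 0 < c) :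
    (X.law a).real {ω | c ≤ |sampleMean fun i => X.sign p z i ω|} ≤ 1 / (n * c ^ 2) := by
  have hprob := X.isProbabilityMeasure_law ha
  have hβ := hf.isProb a
  have hg : Measurable fun x : ℝ => (x - p) / z := by fun_prop
  have := measureReal_sampleMean_deviation_le hn (X.measurable_sign p z)
    ((X.indep_suppliers a ha).comp (fun _ y => (y.1 - p) / z) fun _ => hg.comp measurable_fst)
    (fun i => ?_) (m := 0) (fun i => ?_) hc
  · simpa using this
  · filter_upwards [X.ae_sign_eq hf ha hπ hz i] with ω hω
    rcases hω with h | h <;> rw [h] <;> norm_num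
  · have := X.integral_payment_feature hf ha hπ (h := fun y => (y.1 - p) / z)
      (hg.comp measurable_fst) (integrable_const ((p + z - p) / z))
      (integrable_const ((p - z - p) / z)) i
    rw [show (∫ ω, X.sign p z i ω ∂X.law a) = ∫ ω, (X.P i ω - p) / z ∂X.law a from rfl, this]
    simp [neg_div]

/-- The two signs are equally likely and face the same anticipated allocation q, so Z_i ε_i has mean
half the difference of F((p + z)q) and F((p - z)q). -/
lemma sampleMean_Z_mul_sign_deviation_le (hD : M.DemandAssumption)
    (hΩ : M.AllocationAssumption) (hf : M.ChoiceAssumption) (ha : X.Pr (X.A ⁻¹' {a}) ≠ 0)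
    {p z : ℝ} (hπ : π = perturbedPayment p z) (hz : 0 < z) (hzp : z ≤ p) (hn : 0 < n) {c : ℝ}
    (hc : 0 < c) :
    (X.law a).real {ω | c ≤ |sampleMean (fun i => X.Z i ω * X.sign p z i ω)
      - (M.choiceMean a ((p + z) * X.expectedAlloc a)
        - M.choiceMean a ((p - z) * X.expectedAlloc a)) / 2|} ≤ 1 / (n * c ^ 2) := by
  have hprob := X.isProbabilityMeasure_law ha
  have hg : Measurable fun x : ℝ => (x - p) / z := by fun_prop
  refine measureReal_sampleMean_deviation_le hn (W := fun i ω => X.Z i ω * X.sign p z i ω)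
    (fun i => (X.measurable_Z i).mul (X.measurable_sign p z i))
    ((X.indep_suppliers a ha).comp (fun _ y => y.2.2 * ((y.1 - p) / z)) fun _ => by fun_prop)
    (fun i => ?_) (fun i => ?_) hc
  · filter_upwards [X.ae_sign_eq hf ha hπ hz i] with ω hω
    have := X.Z_mem_Icc i ω
    rcases hω with h | h <;> rw [h] <;> constructor <;> linarith [this.1, this.2]
  · have := X.integral_Z_mul hD hΩ hf ha hπ hz.le hzp hg i
    rw [show (∫ ω, X.Z i ω * X.sign p z i ω ∂X.law a)
      = ∫ ω, X.Z i ω * ((X.P i ω - p) / z) ∂X.law a from rfl, this]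
    rw [add_sub_cancel_left, sub_sub_cancel_left, neg_div, div_self hz.ne']
    ring

end

/-- The population regression coefficient converges to the marginal response of supply to
payments at the mean-field allocation. -/
lemma eventually_abs_regression_sub_le (hD : M.DemandAssumption) (hΩ : M.AllocationAssumption)
    (hf : M.ChoiceAssumption) {a : 𝒜} {p μ : ℝ} (hp : 0 < p) (hμ : M.IsMeanFieldSupply a p μ)
    {z : ℕ → ℝ} (hz : Tendsto z atTop (𝓝 0)) (hz0 : ∀ᶠ n in atTop, 0 < z n)
    {K : ℝ} {G : ℝ → ℝ} (hK : 0 ≤ K) (hG : ∀ x, 0 ≤ x → 0 ≤ G x ∧ G x ≤ 1 + K)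
    (hGL : ∀ x y, 0 ≤ x → 0 ≤ y → |G y - G x| ≤ K * |y - x|)
    (hT : ∀ x y, 0 ≤ x → 0 ≤ y →
      |M.choiceMean a y - M.choiceMean a x - G x * (y - x)| ≤ K * (y - x) ^ 2)
    {η : ℝ} (hη : 0 < η) :
    ∀ᶠ n : ℕ in atTop, ∀ (π : Measure ℝ) (X : EquilibriumPeriod.{u} M n π),
      π = perturbedPayment p (z n) → X.Pr (X.A ⁻¹' {a}) ≠ 0 →
      |(M.choiceMean a ((p + z n) * X.expectedAlloc a)
        - M.choiceMean a ((p - z n) * X.expectedAlloc a)) / 2 / z n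
        - M.allocLim (M.demandMean a / μ) * G (p * M.allocLim (M.demandMean a / μ))| ≤ η := by
  have hw := hΩ.regular.mem_Icc _ (div_pos (hD.mean_pos a) hμ.1).le
  set w := M.allocLim (M.demandMean a / μ) with hw_def
  obtain ⟨C, hC0, hC⟩ := hΩ.exists_alloc_bound
  -- If q is within τ of w, then qG(pq) is within τ(1 + K) + Kpτ = η/2 of wG(pw).
  set τ := η / (2 * (1 + K + K * p)) with hτ
  have hτ0 : 0 < τ := by positivity
  filter_upwards [hz0, hz.eventually_lt_const hp,
    hz.eventually_lt_const (show 0 < η / (2 * (K * C ^ 2 + 1)) by positivity),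
    eventually_abs_expectedAlloc_sub_le.{u} hD hΩ hf hp hμ hz (hz0.mono fun _ => le_of_lt) hτ0]
    with n hz0 hzp hzs halloc π X hπ ha
  have hq := X.expectedAlloc_nonneg hD hΩ ha
  have hqC := X.expectedAlloc_le hD hΩ ha hC
  have hqw := halloc π X hπ ha
  set q := X.expectedAlloc a
  set s := z n
  rw [← hw_def] at hqw
  have h1 := hT (p * q) ((p + s) * q) (by positivity) (by positivity)
  have h2 := hT (p * q) ((p - s) * q) (by positivity) (mul_nonneg (by linarith) hq)
  rw [show (p + s) * q - p * q = s * q by ring, abs_le] at h1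
  rw [show (p - s) * q - p * q = -(s * q) by ring, abs_le] at h2
  -- Both expansions are taken at pq, with linear terms ± s q G(pq) and remainders at most K s² q².
  -- Half their difference, over s, leaves an error of at most K q² s.
  have h3 : |(M.choiceMean a ((p + s) * q) - M.choiceMean a ((p - s) * q)) / 2 / s
      - q * G (p * q)| ≤ K * q ^ 2 * s := by
    rw [div_sub' hz0.ne', abs_div, abs_of_pos hz0, div_le_iff₀ hz0, abs_le]
    constructor <;> nlinarith [h1.1, h1.2, h2.1, h2.2]
  have h4 : K * q ^ 2 * s ≤ η / 2 := by
    rw [lt_div_iff₀ (by positivity)] at hzs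
    have : K * q ^ 2 * s ≤ K * C ^ 2 * s := by gcongr
    linarith
  have h5 : |q * G (p * q) - w * G (p * w)| ≤ η / 2 := by
    have e : q * G (p * q) - w * G (p * w)
        = (q - w) * G (p * q) + w * (G (p * q) - G (p * w)) := by ring
    have hGL' := hGL (p * w) (p * q) (mul_nonneg hp.le hw.1) (mul_nonneg hp.le hq)
    rw [← mul_sub, abs_mul, abs_of_pos hp] at hGL'
    have hGq := hG (p * q) (mul_nonneg hp.le hq)
    calc |q * G (p * q) - w * G (p * w)|
        ≤ |q - w| * G (p * q) + w * |G (p * q) - G (p * w)| := by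
          rw [e]
          refine (abs_add_le _ _).trans_eq ?_
          rw [abs_mul, abs_mul, abs_of_nonneg hGq.1, abs_of_nonneg hw.1]
      _ ≤ τ * (1 + K) + 1 * (K * (p * τ)) := by
          refine add_le_add (mul_le_mul hqw hGq.2 hGq.1 hτ0.le)
            (mul_le_mul hw.2 (hGL'.trans ?_) (abs_nonneg _) zero_le_one)
          gcongr
      _ = η / 2 := by rw [hτ]; field_simp
  refine (abs_sub_le _ (q * G (p * q)) _).trans ?_
  linarith

/-- The regression coefficient is consistent. -/
lemma eventually_deltaHat_deviation_le (hD : M.DemandAssumption) (hΩ : M.AllocationAssumption)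
    (hf : M.ChoiceAssumption) {a : 𝒜} {p μ : ℝ} (hp : 0 < p) (hμ : M.IsMeanFieldSupply a p μ)
    {z : ℕ → ℝ} (hz : Tendsto z atTop (𝓝 0)) (hz0 : ∀ᶠ n in atTop, 0 < z n)
    (hzn : Tendsto (fun n : ℕ => (n : ℝ) * z n ^ 2) atTop atTop)
    {K : ℝ} {G : ℝ → ℝ} (hK : 0 ≤ K) (hG : ∀ x, 0 ≤ x → 0 ≤ G x ∧ G x ≤ 1 + K)
    (hGL : ∀ x y, 0 ≤ x → 0 ≤ y → |G y - G x| ≤ K * |y - x|)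
    (hT : ∀ x y, 0 ≤ x → 0 ≤ y →
      |M.choiceMean a y - M.choiceMean a x - G x * (y - x)| ≤ K * (y - x) ^ 2)
    {ρ θ : ℝ} (hρ : 0 < ρ) (hθ : 0 < θ) :
    ∀ᶠ n : ℕ in atTop, ∀ (π : Measure ℝ) (X : EquilibriumPeriod.{u} M n π),
      π = perturbedPayment p (z n) → X.Pr (X.A ⁻¹' {a}) ≠ 0 →
      (X.law a).real {ω | ρ ≤ |deltaHat (z n) (fun i => X.Z i ω) (fun i => X.sign p (z n) i ω)
        - M.allocLim (M.demandMean a / μ) * G (p * M.allocLim (M.demandMean a / μ))|} ≤ θ := by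
  set Δ := M.allocLim (M.demandMean a / μ) * G (p * M.allocLim (M.demandMean a / μ)) with hΔ
  -- Δ̂ is this function of the rescaled sample covariance and of ε̄, which tends to 0.
  have hcont : ContinuousAt (fun y : ℝ × ℝ => y.1 / (1 - y.2 ^ 2)) (Δ, 0) :=
    continuousAt_fst.div (continuousAt_const.sub (continuousAt_snd.pow 2)) (by simp)
  obtain ⟨κ, hκ, hcont⟩ := hcont.exists_forall_abs_sub_lt hρ
  -- Since Δ̂ divides by z_n, sample means must be controlled at scale z_n. Chebyshev does so
  -- exactly because n z_n² → ∞.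
  have hcheb : Tendsto (fun n : ℕ => 1 / ((n : ℝ) * (κ / 4 * z n) ^ 2)) atTop (𝓝 0) := by
    refine tendsto_const_nhds.div_atTop ?_
    refine (hzn.atTop_mul_const (show 0 < (κ / 4) ^ 2 by positivity)).congr fun n => ?_
    ring
  filter_upwards [hz0, hz.eventually_lt_const hp, hz.eventually_lt_const one_pos,
    eventually_gt_atTop 0, hcheb.eventually_lt_const (half_pos hθ),
    eventually_abs_regression_sub_le.{u} hD hΩ hf hp hμ hz hz0 hK hG hGL hT
      (show 0 < κ / 4 by positivity)]
    with n hz0 hzp hz1 hn hcheb hreg π X hπ ha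
  have hprob := X.isProbabilityMeasure_law ha
  have hreg := hreg π X hπ ha
  have hc : 0 < κ / 4 * z n := by positivity
  have hs := X.sampleMean_sign_deviation_le hf ha hπ hz0 hn hc
  have ht := X.sampleMean_Z_mul_sign_deviation_le hD hΩ hf ha hπ hz0 hzp.le hn hc
  rw [← hΔ] at hreg
  set e := (M.choiceMean a ((p + z n) * X.expectedAlloc a)
    - M.choiceMean a ((p - z n) * X.expectedAlloc a)) / 2
  set s := {ω | κ / 4 * z n ≤ |sampleMean fun i => X.sign p (z n) i ω|}
  set t := {ω | κ / 4 * z n ≤ |sampleMean (fun i => X.Z i ω * X.sign p (z n) i ω) - e|}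
  have hae : ∀ᵐ ω ∂X.law a, ∀ i, X.sign p (z n) i ω = 1 ∨ X.sign p (z n) i ω = -1 :=
    ae_all_iff.2 fun i => X.ae_sign_eq hf ha hπ hz0 i
  -- The inclusion holds almost everywhere only, since the signs are ±1 almost surely.
  have hsub : {ω | ρ ≤ |deltaHat (z n) (fun i => X.Z i ω) (fun i => X.sign p (z n) i ω) - Δ|}
      ≤ᵐ[X.law a] (s ∪ t : Set X.Sample) := by
    filter_upwards [hae] with ω hω hmem
    by_contra hcon
    have hcon' : ω ∉ s ∧ ω ∉ t := by
      constructor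
      · exact fun h => hcon (Or.inl h)
      · exact fun h => hcon (Or.inr h)
    have h1 : |sampleMean fun i => X.sign p (z n) i ω| < κ / 4 * z n := not_le.1 hcon'.1
    have h2 : |sampleMean (fun i => X.Z i ω * X.sign p (z n) i ω) - e| < κ / 4 * z n :=
      not_le.1 hcon'.2
    have hmem' : ρ ≤ |deltaHat (z n) (fun i => X.Z i ω) (fun i => X.sign p (z n) i ω) - Δ| :=
      hmem
    rw [deltaHat_eq hn _ _ _ fun i => by rcases hω i with h | h <;> rw [h] <;> norm_num] at hmem'
    have hZ : |sampleMean fun i => X.Z i ω| ≤ 1 := by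
      rw [sampleMean, abs_of_nonneg (div_nonneg (X.sum_Z_nonneg ω) (Nat.cast_nonneg n))]
      exact div_le_one_of_le₀ (X.sum_Z_le ω) (Nat.cast_nonneg n)
    set E := sampleMean fun i => X.sign p (z n) i ω
    set ZE := sampleMean fun i => X.Z i ω * X.sign p (z n) i ω
    set Zb := sampleMean fun i => X.Z i ω
    -- The two sampling deviations contribute κ/4 each after division by z_n (using |Z̄| ≤ 1), and
    -- the bias e/z_n - Δ another κ/4.
    have h3 : |(z n)⁻¹ * (ZE - Zb * E) - Δ| < κ := by
      have e1 : (z n)⁻¹ * (ZE - Zb * E) - Δ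
          = (z n)⁻¹ * ((ZE - e) - Zb * E) + (e / z n - Δ) := by ring
      have h4 : |(ZE - e) - Zb * E| ≤ κ / 4 * z n + κ / 4 * z n := by
        refine (abs_sub _ _).trans (add_le_add h2.le ?_)
        rw [abs_mul]
        exact (mul_le_of_le_one_left (abs_nonneg _) hZ).trans h1.le
      have h5 : |(z n)⁻¹ * ((ZE - e) - Zb * E)| ≤ κ / 2 := by
        rw [abs_mul, abs_of_pos (inv_pos.2 hz0), inv_mul_le_iff₀ hz0]
        linarith
      rw [e1]
      refine (abs_add_le _ _).trans_lt ?_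
      linarith
    have h6 : |E - 0| < κ := by
      rw [sub_zero]
      refine h1.trans ?_
      nlinarith
    have h7 := hcont _ _ h3 h6
    simp only [ne_eq, OfNat.ofNat_ne_zero, not_false_eq_true, zero_pow, sub_zero, div_one] at h7
    linarith
  calc (X.law a).real _ ≤ (X.law a).real (s ∪ t) :=
        ENNReal.toReal_mono (measure_ne_top _ _) (measure_mono_ae hsub)
    _ ≤ (X.law a).real s + (X.law a).real t := measureReal_union_le _ _
    _ ≤ θ := by linarith

/-- The gradient estimator is consistent in each state. -/
lemma eventually_gammaHat_deviation_le (hD : M.DemandAssumption) (hΩ : M.AllocationAssumption)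
    (hf : M.ChoiceAssumption) (hR : M.RevenueAssumption) {a : 𝒜} {p : ℝ} (hp : 0 < p)
    (hv : M.Viable a p) {z : ℕ → ℝ} (hz : Tendsto z atTop (𝓝 0)) (hz0 : ∀ᶠ n in atTop, 0 < z n)
    (hzn : Tendsto (fun n : ℕ => (n : ℝ) * z n ^ 2) atTop atTop)
    {δ θ : ℝ} (hδ : 0 < δ) (hθ : 0 < θ) :
    ∀ᶠ n : ℕ in atTop, ∀ (π : Measure ℝ) (X : EquilibriumPeriod.{u} M n π),
      π = perturbedPayment p (z n) → X.Pr (X.A ⁻¹' {a}) ≠ 0 →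
      (X.law a).real {ω | δ <
        |gammaHat M.allocLim M.revenueLim p (X.D ω / n) (sampleMean fun i => X.Z i ω)
            (deltaHat (z n) (fun i => X.Z i ω) (fun i => X.sign p (z n) i ω))
          - deriv (M.meanFieldUtility a) p|} ≤ θ := by
  obtain ⟨K, G, hK, hG, hGL, hT⟩ := hf.exists_choiceMean_deriv a
  have hμ := hv.isMeanFieldSupply hD hΩ hf hp
  have hderiv := (hv.hasDerivAt_meanFieldUtility hD hΩ hf hR hp (fun x hx => (hG x hx).1) hT
    rfl).deriv
  have hd := hD.mean_pos a
  set μ := M.meanFieldSupply a p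
  have hw := hΩ.regular.mem_Icc _ (div_pos hd hμ.1).le
  have hΔ0 : 0 ≤ M.allocLim (M.demandMean a / μ) * G (p * M.allocLim (M.demandMean a / μ)) :=
    mul_nonneg hw.1 (hG _ (mul_nonneg hp.le hw.1)).1
  have hzle : ∀ᶠ n in atTop, 0 ≤ z n := hz0.mono fun _ => le_of_lt
  obtain ⟨ρ, hρ, hcont⟩ := Metric.continuousAt_iff.1
    (continuousAt_gammaHat hΩ.regular hR.smooth hp hd hμ.1 hΔ0) δ hδ
  filter_upwards [
    eventually_demand_deviation_le.{u} hD a hρ (show 0 < θ / 3 by positivity),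
    eventually_supply_deviation_le.{u} hD hΩ hf hp hμ hz hzle hρ (show 0 < θ / 3 by positivity),
    eventually_deltaHat_deviation_le.{u} hD hΩ hf hp hμ hz hz0 hzn hK hG hGL hT hρ
      (show 0 < θ / 3 by positivity)] with n h1 h2 h3 π X hπ ha
  have hprob := X.isProbabilityMeasure_law ha
  have h1 := h1 π X ha
  have h2 := h2 π X hπ ha
  have h3 := h3 π X hπ ha
  rw [hderiv]
  set Δ := M.allocLim (M.demandMean a / μ) * G (p * M.allocLim (M.demandMean a / μ))
  set s₁ := {ω | ρ ≤ |X.D ω / n - M.demandMean a|}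
  set s₂ := {ω | ρ ≤ |sampleMean (fun i => X.Z i ω) - μ|}
  set s₃ := {ω | ρ ≤ |deltaHat (z n) (fun i => X.Z i ω) (fun i => X.sign p (z n) i ω) - Δ|}
  -- Continuous mapping: outside three events of probability at most θ/3 each, the statistics are
  -- within ρ of their limits.
  refine (measureReal_mono (s₂ := s₁ ∪ (s₂ ∪ s₃)) fun ω hω => ?_).trans ?_
  · by_contra hcon
    have hm₁ : |X.D ω / n - M.demandMean a| < ρ := not_le.1 fun h => hcon (Or.inl h)
    have hm₂ : |sampleMean (fun i => X.Z i ω) - μ| < ρ :=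
      not_le.1 fun h => hcon (Or.inr (Or.inl h))
    have hm₃ : |deltaHat (z n) (fun i => X.Z i ω) (fun i => X.sign p (z n) i ω) - Δ| < ρ :=
      not_le.1 fun h => hcon (Or.inr (Or.inr h))
    have := hcont (x := ((X.D ω / n, sampleMean fun i => X.Z i ω),
      deltaHat (z n) (fun i => X.Z i ω) fun i => X.sign p (z n) i ω)) (by
        rw [Prod.dist_eq, Prod.dist_eq, max_lt_iff, max_lt_iff]
        exact ⟨⟨hm₁, hm₂⟩, hm₃⟩)
    rw [Real.dist_eq] at this
    exact absurd hω (not_lt.2 this.le)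
  · refine (measureReal_union_le _ _).trans ?_
    have := measureReal_union_le (μ := X.law a) s₂ s₃
    linarith

end EquilibriumPeriod

/-! ### Assembly over the finitely many states -/

theorem mainTheorem1 {𝒜 : Type v} {ℬ : Type w} [Finite 𝒜] [MeasurableSpace 𝒜]
    [MeasurableSingletonClass 𝒜] [MeasurableSpace ℬ] (M : Market 𝒜 ℬ)
    (hD : M.DemandAssumption) (hΩ : M.AllocationAssumption) (hf : M.ChoiceAssumption)
    (hR : M.RevenueAssumption)
    (p ζ α : ℝ) (hζ : 0 < ζ) (hζp : ζ < p) (hα : 0 < α) (hα' : α < 1 / 2)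
    (hp : ∀ a, M.Viable a p)
    (X : ∀ n : ℕ, EquilibriumPeriod.{u} M n (perturbedPayment p (ζ * (n : ℝ) ^ (-α))))
    (ε : ∀ n : ℕ, Fin n → (X n).Sample → ℝ)
    (hε : ∀ n i ω, (X n).P i ω = p + ζ * (n : ℝ) ^ (-α) * ε n i ω) :
    -- the mean-field utility is well defined and is the limit of the expected utilities
    (∀ a p', 0 < p' → M.Viable a p' →
      (∃! μ, M.IsMeanFieldSupply a p' μ) ∧
      ∀ Y : ∀ n : ℕ, EquilibriumPeriod.{u} M n (Measure.dirac p'),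
        (∀ n, (Y n).Pr ((Y n).A ⁻¹' {a}) ≠ 0) →
        Tendsto (fun n => (Y n).utility a) atTop (𝓝 (M.meanFieldUtility a p'))) ∧
    -- it is differentiable at `p`
    (∀ a, DifferentiableAt ℝ (M.meanFieldUtility a) p) ∧
    -- its derivative is the limit in probability of the estimator
    ∀ δ > 0, Tendsto
      (fun n : ℕ => (X n).Pr {ω | δ <
        |gammaHat M.allocLim M.revenueLim p ((X n).D ω / n) (sampleMean fun i => (X n).Z i ω)
            (deltaHat (ζ * (n : ℝ) ^ (-α)) (fun i => (X n).Z i ω) (fun i => ε n i ω))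
          - deriv (M.meanFieldUtility ((X n).A ω)) p|})
      atTop (𝓝 0) := by
  have hp0 : 0 < p := hζ.trans hζp
  refine ⟨fun a p' hp' hv => ⟨hv.existsUnique_isMeanFieldSupply hD hΩ hf hp',
    fun Y hY => EquilibriumPeriod.tendsto_utility hD hΩ hf hR hp' hv Y hY⟩, fun a => ?_, ?_⟩
  · obtain ⟨K, G, -, hG, -, hT⟩ := hf.exists_choiceMean_deriv a
    exact ((hp a).hasDerivAt_meanFieldUtility hD hΩ hf hR hp0 (fun x hx => (hG x hx).1) hT
      rfl).differentiableAt
  intro δ hδ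
  set z : ℕ → ℝ := fun n => ζ * (n : ℝ) ^ (-α) with hz_def
  have hz0 : ∀ᶠ n in atTop, 0 < z n := by
    filter_upwards [eventually_gt_atTop 0] with n hn
    have : (0 : ℝ) < n := Nat.cast_pos.2 hn
    positivity
  have hz : Tendsto z atTop (𝓝 0) := by
    have := ((tendsto_rpow_neg_atTop hα).comp tendsto_natCast_atTop_atTop).const_mul ζ
    simpa [Function.comp_def] using this
  -- n z_n² = ζ² n^(1 - 2α), which is where α < 1/2 enters.
  have hzn : Tendsto (fun n : ℕ => (n : ℝ) * z n ^ 2) atTop atTop := by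
    have h1 : Tendsto (fun n : ℕ => ζ ^ 2 * (n : ℝ) ^ (1 - 2 * α)) atTop atTop :=
      ((tendsto_rpow_atTop (by linarith)).comp tendsto_natCast_atTop_atTop).const_mul_atTop
        (by positivity)
    refine h1.congr' ?_
    filter_upwards [eventually_gt_atTop 0] with n hn
    have hn' : (0 : ℝ) < n := Nat.cast_pos.2 hn
    have e : (n : ℝ) ^ (1 - 2 * α) = n * ((n : ℝ) ^ (-α)) ^ 2 := by
      rw [← Real.rpow_natCast, ← Real.rpow_mul hn'.le, ← Real.rpow_one_add' hn'.le]
      · congr 1; push_cast; ring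
      · push_cast; linarith
    rw [hz_def, e]
    ring
  have := Fintype.ofFinite 𝒜
  set bad : ∀ n, Set (X n).Sample := fun n => {ω | δ <
    |gammaHat M.allocLim M.revenueLim p ((X n).D ω / n) (sampleMean fun i => (X n).Z i ω)
        (deltaHat (ζ * (n : ℝ) ^ (-α)) (fun i => (X n).Z i ω) (fun i => ε n i ω))
      - deriv (M.meanFieldUtility ((X n).A ω)) p|}
  -- On A = a the random target is the constant u_a'(p), so the conditional estimate applies. A
  -- state that is null for some n contributes nothing there, so no lower bound on state
  -- probabilities is needed.
  have hstate : ∀ a, Tendsto (fun n => (X n).Pr ((X n).A ⁻¹' {a} ∩ bad n)) atTop (𝓝 0) := by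
    intro a
    rw [ENNReal.tendsto_nhds_zero]
    intro θ hθ
    obtain ⟨θ', hθ', hθ'θ⟩ := ENNReal.lt_iff_exists_nnreal_btwn.1 hθ
    have hθ'0 : (0 : ℝ) < θ' := by exact_mod_cast hθ'
    filter_upwards [EquilibriumPeriod.eventually_gammaHat_deviation_le.{u} hD hΩ hf hR hp0 (hp a)
      hz hz0 hzn hδ hθ'0, hz0] with n hn hzn0
    refine le_trans ?_ hθ'θ.le
    by_cases ha : (X n).Pr ((X n).A ⁻¹' {a}) = 0
    · rw [measure_mono_null Set.inter_subset_left ha]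
      exact zero_le
    have hprob := (X n).isProbabilityMeasure_law ha
    have hn := hn _ (X n) rfl ha
    have hA : MeasurableSet ((X n).A ⁻¹' {a}) := (X n).measurable_A (measurableSet_singleton a)
    -- The given perturbations are recovered from the payments once z_n ≠ 0.
    have hsign : ∀ i ω, (X n).sign p (z n) i ω = ε n i ω := fun i ω => by
      rw [EquilibriumPeriod.sign, hε, add_sub_cancel_left, mul_div_cancel_left₀ _ hzn0.ne']
    simp_rw [hsign] at hn
    set bad' := {ω | δ <
      |gammaHat M.allocLim M.revenueLim p ((X n).D ω / n) (sampleMean fun i => (X n).Z i ω)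
          (deltaHat (z n) (fun i => (X n).Z i ω) (fun i => ε n i ω))
        - deriv (M.meanFieldUtility a) p|}
    have hsub : (X n).A ⁻¹' {a} ∩ bad n ⊆ (X n).A ⁻¹' {a} ∩ bad' := by
      rintro ω ⟨hω, hb⟩
      have hAω : (X n).A ω = a := hω
      refine ⟨hω, ?_⟩
      change δ < _
      rw [← hAω]
      exact hb
    calc (X n).Pr ((X n).A ⁻¹' {a} ∩ bad n) ≤ (X n).Pr ((X n).A ⁻¹' {a} ∩ bad') :=
          measure_mono hsub
      _ = (X n).law a bad' * (X n).Pr ((X n).A ⁻¹' {a}) := (cond_mul_eq_inter hA bad' _).symm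
      _ ≤ (X n).law a bad' := mul_le_of_le_one_right zero_le prob_le_one
      _ ≤ θ' := by
          rw [← ENNReal.ofReal_coe_nnreal]
          exact (ENNReal.le_ofReal_iff_toReal_le (measure_ne_top _ _) hθ'0.le).2 hn
  have hsum : Tendsto (fun n => ∑ a, (X n).Pr ((X n).A ⁻¹' {a} ∩ bad n)) atTop (𝓝 0) := by
    simpa using tendsto_finsetSum Finset.univ fun a _ => hstate a
  refine tendsto_of_tendsto_of_tendsto_of_le_of_le tendsto_const_nhds hsum
    (fun _ => zero_le) fun n => ?_
  calc (X n).Pr (bad n) ≤ (X n).Pr (⋃ a ∈ (Finset.univ : Finset 𝒜), (X n).A ⁻¹' {a} ∩ bad n) := by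
        refine measure_mono fun ω hω => ?_
        simp only [Set.mem_iUnion]
        exact ⟨(X n).A ω, Finset.mem_univ _, rfl, hω⟩
    _ ≤ _ := measure_biUnion_finset_le _ _
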